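/- Fix an integer $r\ge 1$. For sequences $m=(m_1,\dots,m_r)$, $l=(l_1,\dots,l_r)$ and $k$ put $l_0=k$, $l_{r+1}=0$. Non-negative integers $m,l,k$ are called consistent if $k\ge l_1\ge\dots\ge l_r\ge 0$ and $l_s-l_{s+1}\le m_s$ for $s=1,\dots,r$. For a finite-dimensional space $W\subset\mathbb C[x]$ the exponents of $W$ at $z\in\mathbb C$ (at $\infty$) are the orders of vanishing at $z$ (the degrees) of the nonzero elements of $W$. For consistent $m,l,k$ let $U=U(m,l,k)$ be the unique $(r+1)$-dimensional space of polynomials with the exponents: at $0$: $\{\sum_{t=r-i+1}^r m_t+i\}_{i=0}^r$; at $1$: $\{0,1,\dots,r-1,r+k\}$; at every other $z\in\mathbb C$: $\{0,\dots,r\}$; at $\infty$: $\{\sum_{t=r-i+1}^r m_t+i+l_{r-i}-l_{r-i+1}\}_{i=0}^r$. Likewise let $V=V(m,l,k)$ be an $(r+1)$-dimensional space with the exponents: at $0$: $\{\sum_{t=1}^i m_t+i\}_{i=0}^r$; at $1$: $\{0,k+1,\dots,k+r\}$; at every other $z\in\mathbb C$: $\{0,\dots,r\}$; at $\infty$: $e_0<\dots<e_r$,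 $e_i=k+\sum_{t=1}^i m_t-l_i+l_{i+1}+i$. Such $U$ and $V$ exist. There are unique monic polynomials $u_i=u_i(m,l,k)$, $\deg u_i=l_{r-i}-l_{r-i+1}$ ($i=0,\dots,r$), such that the $u_i\,x^{\sum_{t=r-i+1}^r m_t+i}$ form a basis of $U$. Let $y_r$ be the monic constant multiple of the divided Wronskian $W(f_0,\dots,f_{r-1})\,T_1^{1-r}T_2^{2-r}\cdots T_{r-1}^{-1}$, where $f_j\in V$ has degree $e_j$, $T_1=(x-1)^kx^{m_1}$ and $T_s=x^{m_s}$ for $s\ge2$. For $m,l,k$ with $l_r$ a non-negative integer (the other entries may be complex) and $0\le i\le l_r$ put $$c_i(m,l,k)=\binom{l_r}{i}\prod_{j=0}^{i-1}\prod_{s=1}^r\frac{\sum_{t=r-s+1}^r m_t-l_r+s+j}{\sum_{t=r-s+1}^r m_t-l_r+s+j+1+l_{r-s}-l_{r-s+1}},\qquad F(m,l,k)=\sum_{i=0}^{l_r}(-1)^i c_i(m,l,k)\,x^{l_r-i}.$$ For a permutation $w$ of $\{0,\dots,r\}$ let $w\cdot m$ be the sequence with entries $(w\cdot m)_p=\lambda_{w(p)}-\lambda_{w(p-1)}-1$,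 where $\lambda_i=m_1+\dots+m_i+i$ (so $s_i=(i-1\ \, i)$ replaces $m_{i-1},m_i,m_{i+1}$ by $m_{i-1}+m_i+1,\,-m_i-2,\,m_{i+1}+m_i+1$), and let $(w)_kl$ be the sequence $l'$ with $l'_i-l'_{i+1}=l_{w(i)}-l_{w(i)+1}$ for $i=0,\dots,r$, where $l'_0=k$, $l'_{r+1}=0$ (so $s_i$ replaces $l_i$ by $l_{i-1}+l_{i+1}-l_i$). **Proposition.** (1) For consistent $m,l,k$: no denominator in $c_i(m,l,k)$, $0\le i\le l_r$, vanishes and $u_0(m,l,k)=F(m,l,k)$. (2) For consistent $m,l,k$, every $i\in\{0,\dots,r\}$ and every permutation $w$ with $w(r)=r-i$, no denominator in $F(w\cdot m,(w)_kl,k)$ vanishes and $u_i(m,l,k)=F(w\cdot m,(w)_kl,k)$. (3) For consistent $m,l,k$: $y_r=F(m,l,k)$. (4) These formulas persist for complex parameters. For a fixed partition $l_1\ge\dots\ge l_r\ge0$ and $i<r$ the coefficients of $u_i(m,l,k)$ are the values at consistent $(m,k)$ of rational functions of $(m,k)$ over $\mathbb Q$, and at complex $(m,k)$ the resulting polynomial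 $u_i(m,l,k)$ is $F(w\cdot m,(w)_kl,k)$ for every $w$ with $w(r)=r-i$ (in particular $u_0(m,l,k)=F(m,l,k)$) whenever the denominators in this formula do not vanish. For fixed integers $k\ge l_1\ge\dots\ge l_r\ge0$ the same holds for all $i=0,\dots,r$ with rational functions of $m$ over $\mathbb Q$. -/

import Mathlib

open Polynomial

namespace BetheSpaces

noncomputable section

/-! ### Parameters -/

/-- The entry `a_t` of a sequence `a = (a_1, …, a_r)` (one-based), and `0` for `t ∉ {1, …, r}`. -/
def entry {R : Type*} [Zero R] {r : ℕ} (a : Fin r → R) (t : ℕ) : R :=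
  if h : 1 ≤ t ∧ t ≤ r then a ⟨t - 1, by omega⟩ else 0

/-- The extended sequence `l_0 = k, l_1, …, l_r, l_{r+1} = 0`. -/
def extL {R : Type*} [Zero R] {r : ℕ} (k : R) (l : Fin r → R) (i : ℕ) : R :=
  if i = 0 then k else entry l i

/-- `k ≥ l_1 ≥ l_2 ≥ … ≥ l_r ≥ 0`. -/
def IsPartitionBelow {r : ℕ} (l : Fin r → ℕ) (k : ℕ) : Prop :=
  ∀ i ≤ r, extL k l (i + 1) ≤ extL k l i

/-- `m, l, k` are consistent: `k ≥ l_1 ≥ … ≥ l_r ≥ 0` and `l_s - l_{s+1} ≤ m_s` for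
`s = 1, …, r`. -/
def Consistent {r : ℕ} (m l : Fin r → ℕ) (k : ℕ) : Prop :=
  IsPartitionBelow l k ∧
    ∀ s, 1 ≤ s → s ≤ r → extL k l s ≤ entry m s + extL k l (s + 1)

/-- `d_i = l_i - l_{i+1}`, used only if `k ≥ l_1 ≥ … ≥ l_r ≥ 0`, so that the subtraction
is the honest one. -/
def gap {r : ℕ} (k : ℕ) (l : Fin r → ℕ) (i : ℕ) : ℕ :=
  extL k l i - extL k l (i + 1)

/-- `λ_i(m) = m_1 + … + m_i + i`. -/
def lowSum {R : Type*} [Ring R] {r : ℕ} (m : Fin r → R) (i : ℕ) : R :=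
  ∑ t ∈ Finset.Icc 1 i, entry m t + (i : R)

/-! ### Spaces of polynomials with prescribed exponents -/

/-- The set of exponents of `W` at `z`: orders of zero at `z` of the nonzero elements. -/
def exponentsAt (W : Submodule ℂ ℂ[X]) (z : ℂ) : Set ℕ :=
  {a | ∃ f ∈ W, f ≠ 0 ∧ f.rootMultiplicity z = a}

/-- The set of exponents of `W` at infinity: degrees of the nonzero elements. -/
def exponentsAtInfty (W : Submodule ℂ ℂ[X]) : Set ℕ :=
  {a | ∃ f ∈ W, f ≠ 0 ∧ f.natDegree = a}

/-- `{0, 1 + n_1, 2 + n_1 + n_2, …, r + n_1 + … + n_r}`. -/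
def expSet (r : ℕ) (n : ℕ → ℕ) : Set ℕ :=
  {a | ∃ j ≤ r, a = j + ∑ s ∈ Finset.Icc 1 j, n s}

/-- `e_i = k + m_1 + … + m_i - l_i + l_{i+1} + i`. -/
def expV {r : ℕ} (m l : Fin r → ℕ) (k i : ℕ) : ℕ :=
  ∑ s ∈ Finset.Icc 1 i, entry m s + i + (k - gap k l i)

/-- `m_{r+1-i} + … + m_r + i`. -/
def ordU {r : ℕ} (m : Fin r → ℕ) (i : ℕ) : ℕ :=
  ∑ s ∈ Finset.Icc (r + 1 - i) r, entry m s + i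

/-- `e_i^∨ = m_{r+1-i} + … + m_r - l_{r-i+1} + l_{r-i} + i`. -/
def expU {r : ℕ} (m l : Fin r → ℕ) (k i : ℕ) : ℕ :=
  ordU m i + gap k l (r - i)

/-- `W` has dimension `r + 1`, no singular points outside `{0, 1}`, exponents given by the
sequences `n0`, `n1` at the points `0`, `1`, and exponents `e_0, …, e_r` at infinity. -/
structure HasTwoPointExponents (r : ℕ) (n0 n1 e : ℕ → ℕ) (W : Submodule ℂ ℂ[X]) : Prop where
  finrank_eq : Module.finrank ℂ W = r + 1
  at_zero : exponentsAt W 0 = expSet r n0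
  at_one : exponentsAt W 1 = expSet r n1
  at_other : ∀ z : ℂ, z ≠ 0 → z ≠ 1 → exponentsAt W z = expSet r (fun _ => 0)
  at_infty : exponentsAtInfty W = {a | ∃ i ≤ r, a = e i}

/-- `V` is the space `V(m,l,k)`: `n(0) = (m_1, …, m_r)`, `n(1) = (k, 0, …, 0)`. -/
def IsSpaceV {r : ℕ} (m l : Fin r → ℕ) (k : ℕ) (V : Submodule ℂ ℂ[X]) : Prop :=
  HasTwoPointExponents r (fun s => entry m s) (fun s => if s = 1 then k else 0) (expV m l k) V

/-- `U` is the space `U(m,l,k)`: `n(0) = (m_r, …, m_1)`, `n(1) = (0, …, 0, k)`. -/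
def IsSpaceU {r : ℕ} (m l : Fin r → ℕ) (k : ℕ) (U : Submodule ℂ ℂ[X]) : Prop :=
  HasTwoPointExponents r (fun s => entry m (r + 1 - s)) (fun s => if s = r then k else 0)
    (expU m l k) U

/-- `u_0, …, u_r` are monic polynomials, `deg u_i = l_{r-i} - l_{r-i+1}`, such that
`u_0, u_1 x^{m_r + 1}, …, u_r x^{m_1 + … + m_r + r}` is a basis of `U`. -/
def IsUBasis {r : ℕ} (m l : Fin r → ℕ) (k : ℕ) (U : Submodule ℂ ℂ[X])
    (u : Fin (r + 1) → ℂ[X]) : Prop :=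
  (∀ i, (u i).Monic ∧ (u i).natDegree = gap k l (r - (i : ℕ))) ∧
    LinearIndependent ℂ (fun i : Fin (r + 1) => u i * X ^ ordU m (i : ℕ)) ∧
    Submodule.span ℂ (Set.range fun i : Fin (r + 1) => u i * X ^ ordU m (i : ℕ)) = U

/-! ### The polynomials `y_i` -/

/-- The Wronskian `det (d^a f_b / dx^a)`. -/
def wronskianDet {n : ℕ} (f : Fin n → ℂ[X]) : ℂ[X] :=
  Matrix.det (Matrix.of fun a b : Fin n => derivative^[(a : ℕ)] (f b))

/-- `T_1 = (x-1)^k x^{m_1}` and `T_s = x^{m_s}` for `s = 2, …, r`. -/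
def polyT {r : ℕ} (m : Fin r → ℕ) (k s : ℕ) : ℂ[X] :=
  (if s = 1 then (X - 1) ^ k else 1) * X ^ entry m s

/-- `f_0, …, f_r` is a basis of `V = V(m,l,k)` compatible with the flag at infinity:
`f_j ∈ V` has degree `e_j`, where `e_0 < e_1 < … < e_r` are the exponents at infinity. -/
def IsFlagBasis {r : ℕ} (m l : Fin r → ℕ) (k : ℕ) (V : Submodule ℂ ℂ[X])
    (f : Fin (r + 1) → ℂ[X]) : Prop :=
  ∀ j, f j ∈ V ∧ f j ≠ 0 ∧ (f j).natDegree = expV m l k (j : ℕ)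

/-- `y` is the monic constant multiple of the divided Wronskian
`W(f_0, …, f_{i-1}) T_1^{1-i} T_2^{2-i} ⋯ T_{i-1}^{-1}`, i.e. `y = y_i`. -/
def IsY {r : ℕ} (m : Fin r → ℕ) (k : ℕ) (f : Fin (r + 1) → ℂ[X]) (i : Fin (r + 1))
    (y : ℂ[X]) : Prop :=
  y.Monic ∧ ∃ c : ℂ, c ≠ 0 ∧
    wronskianDet (fun b : Fin (i : ℕ) => f (Fin.castLE i.isLt.le b)) =
      C c * y * ∏ s ∈ Finset.Icc 1 ((i : ℕ) - 1), polyT m k s ^ ((i : ℕ) - s)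

/-! ### The Weyl group actions -/

/-- The shifted action of `S_{r+1}` on `m`: `(w·m)_p = λ_{w(p)}(m) - λ_{w(p-1)}(m) - 1` for
`p = 1, …, r`. For the transposition `s_i = (i-1, i)` it replaces `m_{i-1}, m_i, m_{i+1}` by
`m_{i-1} + m_i + 1, -m_i - 2, m_{i+1} + m_i + 1`. -/
def weylM {R : Type*} [Ring R] {r : ℕ} (w : Equiv.Perm (Fin (r + 1))) (m : Fin r → R) :
    Fin r → R :=
  fun p => lowSum m (w p.succ : ℕ) - lowSum m (w p.castSucc : ℕ) - 1

/-- The action of `S_{r+1}` on `l` that permutes the differences `d_i = l_i - l_{i+1}`,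
`i = 0, …, r`, where `l_0 = k`, `l_{r+1} = 0`: the `i`-th difference of the new sequence is
`d_{w(i)}`. For `s_i = (i-1, i)` it replaces `l_i` by `l_{i-1} + l_{i+1} - l_i`. -/
def weylL {R : Type*} [Ring R] {r : ℕ} (w : Equiv.Perm (Fin (r + 1))) (k : R) (l : Fin r → R) :
    Fin r → R :=
  fun p => ∑ q ∈ Finset.Ici p.succ, (extL k l (w q : ℕ) - extL k l ((w q : ℕ) + 1))

/-! ### The explicit formula

The entries `l_i` and `k` may be complex; the natural number `n` is the value of `l_r`. -/

/-- `m_{r-s+1} + … + m_r - l_r + s + j`. -/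
def numFactor {r : ℕ} (m l : Fin r → ℂ) (j s : ℕ) : ℂ :=
  ∑ t ∈ Finset.Icc (r - s + 1) r, entry m t - entry l r + (s : ℂ) + (j : ℂ)

/-- `m_{r-s+1} + … + m_r - l_r + s + j + 1 + l_{r-s} - l_{r-s+1}`, with `l_0 = k`. -/
def denFactor {r : ℕ} (m l : Fin r → ℂ) (k : ℂ) (j s : ℕ) : ℂ :=
  ∑ t ∈ Finset.Icc (r - s + 1) r, entry m t - entry l r + (s : ℂ) + (j : ℂ) + 1
    + extL k l (r - s) - extL k l (r - s + 1)

/-- `c_i(m,l,k)`, where `n = l_r`. -/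
def coeffC {r : ℕ} (n : ℕ) (m l : Fin r → ℂ) (k : ℂ) (i : ℕ) : ℂ :=
  (n.choose i : ℂ) *
    ∏ j ∈ Finset.range i, ∏ s ∈ Finset.Icc 1 r, numFactor m l j s / denFactor m l k j s

/-- `∑_{i=0}^{n} (-1)^i c_i(m,l,k) x^{n - i}`, where `n = l_r`. -/
def explicitU {r : ℕ} (n : ℕ) (m l : Fin r → ℂ) (k : ℂ) : ℂ[X] :=
  ∑ i ∈ Finset.range (n + 1), C ((-1) ^ i * coeffC n m l k i) * X ^ (n - i)

/-- No denominator occurring in `c_i(m,l,k)`, `0 ≤ i ≤ n = l_r`, vanishes. -/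
def DenNonzero {r : ℕ} (n : ℕ) (m l : Fin r → ℂ) (k : ℂ) : Prop :=
  ∀ j < n, ∀ s, 1 ≤ s → s ≤ r → denFactor m l k j s ≠ 0

/-! ### Extension to complex parameters -/

/-- `S` is a set of pairs (point, polynomial). The polynomial `p` is the value at `x` of a
polynomial whose coefficients are rational functions over `ℚ` of the point, regular at `x`, and
which takes the prescribed value `q` at `y` for every pair `(y, q) ∈ S`. Numerators are collected
in `P`, and `Q` is a common denominator. -/
def IsRationalExtension {n : ℕ} (S : Set ((Fin n → ℂ) × ℂ[X])) (x : Fin n → ℂ) (p : ℂ[X]) :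
    Prop :=
  ∃ (P : (MvPolynomial (Fin n) ℚ)[X]) (Q : MvPolynomial (Fin n) ℚ),
    (∀ y q, (y, q) ∈ S → MvPolynomial.aeval y Q ≠ 0 ∧
      C (MvPolynomial.aeval y Q) * q = P.map (MvPolynomial.aeval y : _ →ₐ[ℚ] ℂ).toRingHom) ∧
    MvPolynomial.aeval x Q ≠ 0 ∧
      C (MvPolynomial.aeval x Q) * p = P.map (MvPolynomial.aeval x : _ →ₐ[ℚ] ℂ).toRingHom

/-- The sequence of complex numbers given by a sequence of natural numbers. -/
def toC {r : ℕ} (a : Fin r → ℕ) : Fin r → ℂ := fun t => (a t : ℂ)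

/-- For fixed `l`: the points `(k, m_1, …, m_r)` with `m, l, k` consistent, each paired with
`u_i(m,l,k)`. -/
def graphMK {r : ℕ} (l : Fin r → ℕ) (i : Fin (r + 1)) : Set ((Fin (r + 1) → ℂ) × ℂ[X]) :=
  {z | ∃ (m : Fin r → ℕ) (k : ℕ) (U : Submodule ℂ ℂ[X]) (u : Fin (r + 1) → ℂ[X]),
    Consistent m l k ∧ IsSpaceU m l k U ∧ IsUBasis m l k U u ∧
      z = (Fin.cons (k : ℂ) (toC m), u i)}

/-- For fixed `l, k`: the points `(m_1, …, m_r)` with `m, l, k` consistent, each paired with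
`u_i(m,l,k)`. -/
def graphM {r : ℕ} (l : Fin r → ℕ) (k : ℕ) (i : Fin (r + 1)) : Set ((Fin r → ℂ) × ℂ[X]) :=
  {z | ∃ (m : Fin r → ℕ) (U : Submodule ℂ ℂ[X]) (u : Fin (r + 1) → ℂ[X]),
    Consistent m l k ∧ IsSpaceU m l k U ∧ IsUBasis m l k U u ∧
      z = (toC m, u i)}

end

end BetheSpaces

open BetheSpaces

namespace BetheSpaces

noncomputable section

/-! The basis element `u_i x^{ordU i}` of `U` is supported on the block of integers `[ordU i, expU
i]`. Consistency makes these `r + 1` blocks disjoint, and since the gaps `l_i - l_{i+1}` add up to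
`k`, their union `S` has `r + k + 1` points. The top exponent at `1` says that some nonzero `g` in
`U` is divisible by `(x - 1)^{r+k}`. A polynomial supported on `M + 1` points and divisible by `(x -
1)^M` is unique up to a factor: its coefficients annihilate all polynomials of degree `< M` on `S`,
so the coefficient at `n` is proportional to `1 / ∏_{t ∈ S, t ≠ n} (n - t)`. In particular no
coefficient of `g` on `S` is zero, and each basis element is proportional to the restriction of `g`
to its block.

As `S` is a union of intervals, the ratio of neighbouring coefficients telescopes to a quotient of
products over the ends of the blocks (`coeff_recursion`). Solved downwards from the leading
coefficient, this is the explicit formula (`isUBasis_explicit`). All blocks but the one in question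
enter symmetrically, so a permutation `w` matters only through `w(r)`.

Conversely, cutting such a `g` into blocks produces `U`. Its Wronskian has degree minus order at `0`
equal to `k`, and the point `1` uses up all of it, which pins down every other exponent
(`exponents_block_space`).

The Wronskians of `r` out of `r + 1` basis elements, divided by their common factor, span a dual
space with complementary exponents (`divided_dualSpan`). This constructs `V` from `U`. In the other
direction it identifies `y_r` with the element of least degree of `U`, which is `u_0`
(`isY_last_iff`).

For complex parameters the formula is a quotient of polynomials over `ℚ` in the parameters, and an
identity of such polynomials can be tested at large natural points, all of which are consistent
(`IsRationalExtension.unique`). -/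

/-- `n` is the least index at which a functional of the family `φ` does not vanish on `x`. -/
def IsLead {ι M : Type*} [LT ι] [AddCommGroup M] [Module ℂ M] (φ : ι → M →ₗ[ℂ] ℂ) (x : M)
    (n : ι) : Prop :=
  φ n x ≠ 0 ∧ ∀ m < n, φ m x = 0

/-! ### Echelon bases with respect to an ordered family of functionals -/

section Lead

variable {ι κ M : Type*} [LinearOrder ι] [AddCommGroup M] [Module ℂ M] {φ : ι → M →ₗ[ℂ] ℂ}

/-- Distinct leading indices exclude cancellation: among the terms with nonzero coefficient, the one
of least index decides. -/
theorem IsLead.sum {g : κ → M} {a : κ → ι} (ha : Function.Injective a)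
    (h : ∀ i, IsLead φ (g i) (a i)) (s : Finset κ) (c : κ → ℂ) {i : κ} (hi : i ∈ s)
    (hci : c i ≠ 0) :
    ∃ j ∈ s, c j ≠ 0 ∧ IsLead φ (∑ i ∈ s, c i • g i) (a j) := by
  classical
  obtain ⟨j, hj, hmin⟩ := (s.filter fun i => c i ≠ 0).exists_min_image a
    ⟨i, Finset.mem_filter.2 ⟨hi, hci⟩⟩
  rw [Finset.mem_filter] at hj
  have key : ∀ i ∈ s, ∀ n, n ≤ a j → (n = a j → i ≠ j) → φ n (c i • g i) = 0 := by
    intro i hi n hn hne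
    by_cases hc : c i = 0
    · simp [hc]
    have h1 := hmin i (Finset.mem_filter.2 ⟨hi, hc⟩)
    have h2 : n < a i := by
      rcases hn.lt_or_eq with hlt | heq
      · exact hlt.trans_le h1
      · refine lt_of_le_of_ne (hn.trans h1) fun he => hne heq (ha ?_)
        rw [← he, heq]
    simp [(h i).2 n h2]
  refine ⟨j, hj.1, hj.2, ?_, fun n hn => ?_⟩
  · rw [map_sum, Finset.sum_eq_single_of_mem j hj.1 fun b hb hbj => key b hb _ le_rfl fun _ => hbj]
    simpa using ⟨hj.2, (h j).1⟩
  · rw [map_sum]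
    exact Finset.sum_eq_zero fun b hb => key b hb n hn.le fun he => absurd he hn.ne

theorem linearIndependent_of_isLead {g : κ → M} {a : κ → ι} (ha : Function.Injective a)
    (h : ∀ i, IsLead φ (g i) (a i)) : LinearIndependent ℂ g := by
  rw [linearIndependent_iff']
  intro s c hc i hi
  by_contra hne
  obtain ⟨j, _, _, hl⟩ := IsLead.sum ha h s c hi hne
  rw [hc] at hl
  exact hl.1 (map_zero _)

theorem exists_isLead_of_mem_span [Fintype κ] {g : κ → M} {a : κ → ι} (ha : Function.Injective a)
    (h : ∀ i, IsLead φ (g i) (a i)) {x : M} (hx : x ∈ Submodule.span ℂ (Set.range g))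
    (hx0 : x ≠ 0) : ∃ j, IsLead φ x (a j) := by
  obtain ⟨c, rfl⟩ := (Submodule.mem_span_range_iff_exists_fun ℂ).1 hx
  have : ∃ i, c i ≠ 0 := by
    by_contra! hc
    exact hx0 (by simp [hc])
  obtain ⟨i, hi⟩ := this
  obtain ⟨j, _, _, hj⟩ := IsLead.sum ha h Finset.univ c (Finset.mem_univ i) hi
  exact ⟨j, hj⟩

/-- A finite-dimensional space has an echelon basis. -/
theorem exists_strictMono_isLead {W : Submodule ℂ M} {n : ℕ} (hn : Module.finrank ℂ W = n + 1)
    (hlead : ∀ x ∈ W, x ≠ 0 → ∃ a, IsLead φ x a) :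
    ∃ (α : Fin (n + 1) → ι) (g : Fin (n + 1) → M), StrictMono α ∧ ∀ i, g i ∈ W ∧
      IsLead φ (g i) (α i) := by
  classical
  have : FiniteDimensional ℂ W := Module.finite_of_finrank_pos (by omega)
  let A : Set ι := {a | ∃ x ∈ W, IsLead φ x a}
  have hA : ∀ a : A, ∃ x ∈ W, IsLead φ x a := fun a => a.2
  choose g hgW hg using hA
  have hli : LinearIndependent ℂ g := linearIndependent_of_isLead Subtype.val_injective hg
  let g' : A → W := fun a => ⟨g a, hgW a⟩
  have hli' : LinearIndependent ℂ g' := by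
    refine LinearIndependent.of_comp W.subtype ?_
    exact hli
  have : Finite A := hli'.finite
  have : Fintype A := Fintype.ofFinite A
  have hspan : ⊤ ≤ Submodule.span ℂ (Set.range g') := by
    by_contra hnot
    have hex : ∃ x ∈ W, x ∉ Submodule.span ℂ (Set.range g) := by
      by_contra! hall
      refine hnot fun y _ => ?_
      obtain ⟨c, hc⟩ := (Submodule.mem_span_range_iff_exists_fun ℂ).1 (hall y y.2)
      exact (Submodule.mem_span_range_iff_exists_fun ℂ).2 ⟨c, Subtype.ext (by simpa [g'] using hc)⟩
    -- Take the largest leading index `a` of an element outside the span. Subtracting a multiple of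
    -- `g a` keeps the element outside the span but moves its leading index past `a`, a
    -- contradiction.
    let B : Set A := {a | ∃ x ∈ W, x ∉ Submodule.span ℂ (Set.range g) ∧ IsLead φ x a}
    have hB : B.Nonempty := by
      obtain ⟨x, hxW, hx⟩ := hex
      obtain ⟨a, ha⟩ := hlead x hxW (fun h => hx (h ▸ Submodule.zero_mem _))
      exact ⟨⟨a, x, hxW, ha⟩, x, hxW, hx, ha⟩
    obtain ⟨a, ⟨x, hxW, hx, hxa⟩, hmax⟩ := (Set.toFinite B).exists_maximalFor id B hB
    let c := φ a x / φ a (g a)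
    have hmem : x - c • g a ∈ W := W.sub_mem hxW (W.smul_mem _ (hgW a))
    have hnot' : x - c • g a ∉ Submodule.span ℂ (Set.range g) := by
      intro h
      apply hx
      have := Submodule.add_mem _ h
        (Submodule.smul_mem _ c (Submodule.subset_span (Set.mem_range_self a)))
      simpa using this
    obtain ⟨b, hb⟩ := hlead _ hmem (fun h => hnot' (h ▸ Submodule.zero_mem _))
    have hab : (a : ι) < b := by
      by_contra! hle
      apply hb.1
      rcases hle.lt_or_eq with hlt | heq
      · simp [hxa.2 b hlt, (hg a).2 b hlt]
      · subst heq
        simp only [map_sub, map_smul, smul_eq_mul, c]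
        rw [div_mul_cancel₀ _ (hg a).1, sub_self]
    have := @hmax ⟨b, _, hmem, hb⟩ ⟨_, hmem, hnot', hb⟩ (le_of_lt hab)
    exact absurd hab (not_lt.2 this)
  have hcard : Fintype.card A = n + 1 := by
    rw [← hn, Module.finrank_eq_card_basis (Module.Basis.mk hli' hspan)]
  let e := Fintype.orderIsoFinOfCardEq A hcard
  exact ⟨fun i => e i, fun i => g (e i), fun i j hij => e.strictMono hij,
    fun i => ⟨hgW _, hg _⟩⟩

end Lead

/-! ### Orders of zero and degrees as leading indices -/

/-- The `n`-th Taylor coefficient at `z`. -/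
def taylorCoeff (z : ℂ) (n : ℕ) : ℂ[X] →ₗ[ℂ] ℂ := lcoeff ℂ n ∘ₗ taylor z

theorem taylorCoeff_apply (z : ℂ) (n : ℕ) (f : ℂ[X]) : taylorCoeff z n f = (taylor z f).coeff n :=
  rfl

theorem X_sub_C_pow_dvd_iff_taylor {z : ℂ} {n : ℕ} {f : ℂ[X]} :
    (X - C z) ^ n ∣ f ↔ X ^ n ∣ taylor z f := by
  have h : ∀ g : ℂ[X], taylor (-z) (taylor z g) = g := fun g => by simp [taylor_taylor]
  constructor
  · rintro ⟨g, rfl⟩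
    refine ⟨taylor z g, ?_⟩
    simp [taylor_mul, taylor_pow]
  · rintro ⟨g, hg⟩
    refine ⟨taylor (-z) g, ?_⟩
    rw [← h f, hg]
    simp [taylor_mul, taylor_pow, sub_eq_add_neg]

theorem isLead_taylorCoeff_iff {z : ℂ} {f : ℂ[X]} {n : ℕ} :
    IsLead (taylorCoeff z) f n ↔ f ≠ 0 ∧ f.rootMultiplicity z = n := by
  have hd : ∀ n, (∀ m < n, taylorCoeff z m f = 0) ↔ (X - C z) ^ n ∣ f := fun n => by
    rw [X_sub_C_pow_dvd_iff_taylor, X_pow_dvd_iff]; rfl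
  have h2 : IsLead (taylorCoeff z) f n ↔ (X - C z) ^ n ∣ f ∧ ¬ (X - C z) ^ (n + 1) ∣ f := by
    rw [← hd, ← hd, IsLead]
    constructor
    · rintro ⟨h, h'⟩
      exact ⟨h', fun h'' => h (h'' n (Nat.lt_succ_self n))⟩
    · rintro ⟨h', h⟩
      refine ⟨fun h0 => h fun m hm => ?_, h'⟩
      rcases Nat.lt_succ_iff_lt_or_eq.1 hm with hlt | rfl
      · exact h' m hlt
      · exact h0
  rw [h2]
  constructor
  · rintro ⟨h, h'⟩
    have h0 : f ≠ 0 := fun h0 => h' (h0 ▸ dvd_zero _)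
    refine ⟨h0, le_antisymm ?_ ((le_rootMultiplicity_iff h0).2 h)⟩
    by_contra! hlt
    exact h' ((le_rootMultiplicity_iff h0).1 hlt)
  · rintro ⟨h0, rfl⟩
    exact ⟨pow_rootMultiplicity_dvd f z, fun h =>
      absurd ((le_rootMultiplicity_iff h0).2 h) (by omega)⟩

/-- Reversing the order of `ℕ` turns the degree into a least index, so the same echelon argument
serves finite points and infinity. -/
theorem isLead_lcoeff_iff {f : ℂ[X]} {n : ℕᵒᵈ} :
    IsLead (fun n : ℕᵒᵈ => lcoeff ℂ (OrderDual.ofDual n)) f n ↔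
      f ≠ 0 ∧ f.natDegree = OrderDual.ofDual n := by
  constructor
  · rintro ⟨h, h'⟩
    refine ⟨fun h0 => h (by simp [h0]), le_antisymm ?_ (le_natDegree_of_ne_zero h)⟩
    exact natDegree_le_iff_coeff_eq_zero.2 fun N hN => h' (OrderDual.toDual N) hN
  · rintro ⟨h0, h⟩
    refine ⟨?_, fun m hm => ?_⟩
    · simpa [← h] using h0
    · exact coeff_eq_zero_of_natDegree_lt (h ▸ hm)

/-! ### Exponents of a span and adapted bases -/

section Exponents

variable {r : ℕ} {g : Fin (r + 1) → ℂ[X]} {α : Fin (r + 1) → ℕ}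

theorem linearIndependent_of_rootMultiplicity (z : ℂ) (hα : Function.Injective α)
    (h0 : ∀ i, g i ≠ 0) (h : ∀ i, (g i).rootMultiplicity z = α i) : LinearIndependent ℂ g :=
  linearIndependent_of_isLead hα fun i => isLead_taylorCoeff_iff.2 ⟨h0 i, h i⟩

theorem exponentsAt_span (z : ℂ) (hα : Function.Injective α)
    (h0 : ∀ i, g i ≠ 0) (h : ∀ i, (g i).rootMultiplicity z = α i) :
    exponentsAt (Submodule.span ℂ (Set.range g)) z = Set.range α := by
  ext a
  constructor
  · rintro ⟨f, hf, hf0, rfl⟩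
    obtain ⟨j, hj⟩ := exists_isLead_of_mem_span hα
      (fun i => isLead_taylorCoeff_iff.2 ⟨h0 i, h i⟩) hf hf0
    exact ⟨j, ((isLead_taylorCoeff_iff.1 hj).2).symm⟩
  · rintro ⟨i, rfl⟩
    exact ⟨g i, Submodule.subset_span ⟨i, rfl⟩, h0 i, h i⟩

theorem exponentsAtInfty_span (hα : Function.Injective α)
    (h0 : ∀ i, g i ≠ 0) (h : ∀ i, (g i).natDegree = α i) :
    exponentsAtInfty (Submodule.span ℂ (Set.range g)) = Set.range α := by
  ext a
  constructor
  · rintro ⟨f, hf, hf0, rfl⟩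
    obtain ⟨j, hj⟩ := exists_isLead_of_mem_span (a := fun i => OrderDual.toDual (α i))
      (OrderDual.toDual.injective.comp hα)
      (fun i => isLead_lcoeff_iff.2 ⟨h0 i, h i⟩) hf hf0
    exact ⟨j, ((isLead_lcoeff_iff.1 hj).2).symm⟩
  · rintro ⟨i, rfl⟩
    exact ⟨g i, Submodule.subset_span ⟨i, rfl⟩, h0 i, h i⟩

theorem linearIndependent_of_natDegree (hα : Function.Injective α)
    (h0 : ∀ i, g i ≠ 0) (h : ∀ i, (g i).natDegree = α i) : LinearIndependent ℂ g :=
  linearIndependent_of_isLead (a := fun i => OrderDual.toDual (α i))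
    (OrderDual.toDual.injective.comp hα) fun i => isLead_lcoeff_iff.2 ⟨h0 i, h i⟩

theorem span_eq_of_linearIndependent {W : Submodule ℂ ℂ[X]} (hW : Module.finrank ℂ W = r + 1)
    (hg : ∀ i, g i ∈ W) (hli : LinearIndependent ℂ g) :
    Submodule.span ℂ (Set.range g) = W := by
  have : FiniteDimensional ℂ W := Module.finite_of_finrank_pos (by omega)
  refine Submodule.eq_of_le_of_finrank_eq (Submodule.span_le.2 ?_) ?_
  · rintro _ ⟨i, rfl⟩
    exact hg i
  · rw [finrank_span_eq_card hli, hW, Fintype.card_fin]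

/-- A basis adapted to the orders at `z`. -/
theorem exists_adapted_basis {W : Submodule ℂ ℂ[X]} (hW : Module.finrank ℂ W = r + 1) (z : ℂ) :
    ∃ (α : Fin (r + 1) → ℕ) (g : Fin (r + 1) → ℂ[X]), StrictMono α ∧
      (∀ i, g i ≠ 0 ∧ (g i).rootMultiplicity z = α i) ∧
      Submodule.span ℂ (Set.range g) = W := by
  obtain ⟨α, g, hα, h⟩ := exists_strictMono_isLead (φ := taylorCoeff z) hW
    fun x _ hx => ⟨_, isLead_taylorCoeff_iff.2 ⟨hx, rfl⟩⟩
  refine ⟨α, g, hα, fun i => isLead_taylorCoeff_iff.1 (h i).2, ?_⟩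
  exact span_eq_of_linearIndependent hW (fun i => (h i).1)
    (linearIndependent_of_isLead hα.injective fun i => (h i).2)

theorem exists_basis_of_exponentsAt {W : Submodule ℂ ℂ[X]} (hW : Module.finrank ℂ W = r + 1)
    {z : ℂ} (hα : Function.Injective α) (h : exponentsAt W z = Set.range α) :
    ∃ g : Fin (r + 1) → ℂ[X], (∀ i, g i ≠ 0 ∧ (g i).rootMultiplicity z = α i) ∧
      Submodule.span ℂ (Set.range g) = W := by
  have hex : ∀ i, α i ∈ exponentsAt W z := fun i => h ▸ ⟨i, rfl⟩
  choose g hg hg0 hgα using hex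
  exact ⟨g, fun i => ⟨hg0 i, hgα i⟩, span_eq_of_linearIndependent hW hg
    (linearIndependent_of_rootMultiplicity z hα hg0 hgα)⟩

theorem exists_basis_of_exponentsAtInfty {W : Submodule ℂ ℂ[X]}
    (hW : Module.finrank ℂ W = r + 1)
    (hα : Function.Injective α) (h : exponentsAtInfty W = Set.range α) :
    ∃ g : Fin (r + 1) → ℂ[X], (∀ i, g i ≠ 0 ∧ (g i).natDegree = α i) ∧
      Submodule.span ℂ (Set.range g) = W := by
  have hex : ∀ i, α i ∈ exponentsAtInfty W := fun i => h ▸ ⟨i, rfl⟩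
  choose g hg hg0 hgα using hex
  exact ⟨g, fun i => ⟨hg0 i, hgα i⟩, span_eq_of_linearIndependent hW hg
    (linearIndependent_of_natDegree hα hg0 hgα)⟩

end Exponents

/-! ### Orders, degrees and base change of Wronskians -/

section Wronskian

variable {n : ℕ}

/-- The operator `x^a (d/dx)^a` is diagonal on monomials. Multiplying row `a` of a Wronskian matrix
by `x^a` therefore preserves the lowest and highest degrees occurring in each column. -/
theorem coeff_X_pow_mul_iterate_derivative (f : ℂ[X]) (a m : ℕ) :
    (X ^ a * derivative^[a] f).coeff m = (m.descFactorial a : ℂ) * f.coeff m := by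
  rw [mul_comm, coeff_mul_X_pow']
  split_ifs with h
  · rw [coeff_iterate_derivative, Nat.sub_add_cancel h, nsmul_eq_mul]
  · rw [Nat.descFactorial_eq_zero_iff_lt.2 (not_le.1 h)]
    simp

/-- Falling factorials are monic of degree `a` in `β b`, so this is a Vandermonde determinant. -/
theorem det_descFactorial_ne_zero {β : Fin n → ℕ} (hβ : Function.Injective β) :
    (Matrix.of fun a b : Fin n => ((β b).descFactorial a : ℂ)).det ≠ 0 := by
  have h := Matrix.det_eval_matrixOfPolynomials_eq_det_vandermonde (fun i => (β i : ℂ))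
    (fun i : Fin n => descPochhammer ℂ i) (fun i => descPochhammer_natDegree ℂ i)
    (fun i => monic_descPochhammer ℂ i)
  rw [← Matrix.det_transpose]
  have h2 : (Matrix.of fun a b : Fin n => ((β b).descFactorial a : ℂ)).transpose =
      Matrix.of fun i j : Fin n => (descPochhammer ℂ (j : ℕ)).eval (β i : ℂ) := by
    ext i j
    simp [descPochhammer_eval_eq_descFactorial]
  rw [h2, ← h, Matrix.det_vandermonde_ne_zero_iff]
  exact fun i j hij => hβ (Nat.cast_injective hij)

theorem det_X_pow_mul_iterate_derivative (f : Fin n → ℂ[X]) :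
    (Matrix.of fun a b : Fin n => X ^ (a : ℕ) * derivative^[(a : ℕ)] (f b)).det =
      X ^ (∑ i : Fin n, (i : ℕ)) * wronskianDet f := by
  rw [← Finset.prod_pow_eq_pow_sum]
  exact Matrix.det_mul_column (fun a : Fin n => (X : ℂ[X]) ^ (a : ℕ))
    (Matrix.of fun a b : Fin n => derivative^[(a : ℕ)] (f b))

theorem det_lead_ne_zero {β : Fin n → ℕ} (hβ : Function.Injective β) {c : Fin n → ℂ}
    (hc : ∀ i, c i ≠ 0) :
    (Matrix.of fun a b : Fin n => ((β b).descFactorial a : ℂ) * c b).det ≠ 0 := by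
  have h := Matrix.det_mul_row c (Matrix.of fun a b : Fin n => ((β b).descFactorial a : ℂ))
  simp only [Matrix.of_apply, mul_comm (c _)] at h
  rw [h]
  exact mul_ne_zero (Finset.prod_ne_zero_iff.2 fun i _ => hc i) (det_descFactorial_ne_zero hβ)

/-- After the rows are scaled, `x^{α_b}` comes out of column `b`. What remains has at `0` the matrix
of falling factorials of the `α_b`, with columns scaled by lowest coefficients, and this is
nonsingular. -/
theorem wronskianDet_order_zero {f : Fin n → ℂ[X]} {α : Fin n → ℕ} (hα : Function.Injective α)
    (hf : ∀ i, f i ≠ 0) (hfα : ∀ i, (f i).rootMultiplicity 0 = α i) :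
    wronskianDet f ≠ 0 ∧
      (wronskianDet f).rootMultiplicity 0 + ∑ i : Fin n, (i : ℕ) = ∑ i, α i := by
  have hlead : ∀ i, (f i).coeff (α i) ≠ 0 ∧ ∀ m < α i, (f i).coeff m = 0 := by
    intro i
    have := isLead_taylorCoeff_iff.2 ⟨hf i, hfα i⟩
    simpa [IsLead, taylorCoeff_apply] using this
  have hdvd : ∀ a b : Fin n, ∃ q : ℂ[X],
      X ^ (a : ℕ) * derivative^[(a : ℕ)] (f b) = X ^ α b * q ∧
        q.eval 0 = ((α b).descFactorial a : ℂ) * (f b).coeff (α b) := by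
    intro a b
    obtain ⟨q, hq⟩ : X ^ α b ∣ X ^ (a : ℕ) * derivative^[(a : ℕ)] (f b) := by
      rw [X_pow_dvd_iff]
      intro d hd
      rw [coeff_X_pow_mul_iterate_derivative, (hlead b).2 d hd, mul_zero]
    refine ⟨q, hq, ?_⟩
    rw [← coeff_X_pow_mul_iterate_derivative, hq, ← coeff_zero_eq_eval_zero]
    simpa using (coeff_X_pow_mul q (α b) 0).symm
  choose q hq hq0 using hdvd
  have hdet : X ^ (∑ i : Fin n, (i : ℕ)) * wronskianDet f =
      X ^ (∑ i, α i) * (Matrix.of q).det := by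
    rw [← det_X_pow_mul_iterate_derivative, ← Finset.prod_pow_eq_pow_sum,
      ← Matrix.det_mul_row]
    simp_rw [hq]
    rfl
  have heval : (Matrix.of q).det.eval 0 ≠ 0 := by
    rw [← coe_evalRingHom, RingHom.map_det]
    have : (evalRingHom (0 : ℂ)).mapMatrix (Matrix.of q) =
        Matrix.of fun a b : Fin n => ((α b).descFactorial a : ℂ) * (f b).coeff (α b) := by
      ext a b
      simp [hq0]
    rw [this]
    exact det_lead_ne_zero hα fun i => (hlead i).1
  have hq0' : (Matrix.of q).det ≠ 0 := fun h => heval (by simp [h])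
  have hne : X ^ (∑ i, α i) * (Matrix.of q).det ≠ 0 := mul_ne_zero (pow_ne_zero _ X_ne_zero) hq0'
  have hw : wronskianDet f ≠ 0 := fun h => hne (by rw [← hdet, h, mul_zero])
  refine ⟨hw, ?_⟩
  have hX : ∀ N, (X ^ N : ℂ[X]).rootMultiplicity 0 = N := fun N => by
    simpa using rootMultiplicity_X_sub_C_pow (0 : ℂ) N
  have := congrArg (rootMultiplicity 0) hdet
  rw [rootMultiplicity_mul (hdet ▸ hne), rootMultiplicity_mul hne, hX, hX,
    rootMultiplicity_eq_zero (p := (Matrix.of q).det) heval] at this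
  omega

theorem taylor_iterate_derivative (z : ℂ) (a : ℕ) (f : ℂ[X]) :
    taylor z (derivative^[a] f) = derivative^[a] (taylor z f) := by
  induction a generalizing f with
  | zero => rfl
  | succ a ih =>
    rw [Function.iterate_succ_apply, ih, Function.iterate_succ_apply]
    congr 1
    simp [taylor_apply, derivative_comp]

theorem wronskianDet_taylor (z : ℂ) (f : Fin n → ℂ[X]) :
    taylor z (wronskianDet f) = wronskianDet fun i => taylor z (f i) := by
  have h := AlgHom.map_det (taylorAlgHom z)
    (Matrix.of fun a b : Fin n => derivative^[(a : ℕ)] (f b))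
  refine Eq.trans h ?_
  unfold wronskianDet
  congr 1
  ext a b : 2
  simp [← taylor_iterate_derivative]

theorem rootMultiplicity_taylor (z : ℂ) (f : ℂ[X]) :
    (taylor z f).rootMultiplicity 0 = f.rootMultiplicity z := by
  rw [taylor_apply, ← rootMultiplicity_eq_rootMultiplicity]

theorem wronskianDet_order {f : Fin n → ℂ[X]} {α : Fin n → ℕ} (z : ℂ)
    (hα : Function.Injective α)
    (hf : ∀ i, f i ≠ 0) (hfα : ∀ i, (f i).rootMultiplicity z = α i) :
    wronskianDet f ≠ 0 ∧
      (wronskianDet f).rootMultiplicity z + ∑ i : Fin n, (i : ℕ) = ∑ i, α i := by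
  have h := wronskianDet_order_zero (f := fun i => taylor z (f i)) hα
    (fun i => by simpa using hf i) (fun i => by rw [rootMultiplicity_taylor, hfα])
  rw [← wronskianDet_taylor, rootMultiplicity_taylor] at h
  exact ⟨fun h0 => h.1 (by simp [h0]), h.2⟩

theorem natDegree_prod_le_and_coeff {ι : Type*} (s : Finset ι) (p : ι → ℂ[X]) (β : ι → ℕ)
    (h : ∀ i ∈ s, (p i).natDegree ≤ β i) :
    (∏ i ∈ s, p i).natDegree ≤ ∑ i ∈ s, β i ∧
      (∏ i ∈ s, p i).coeff (∑ i ∈ s, β i) = ∏ i ∈ s, (p i).coeff (β i) := by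
  classical
  induction s using Finset.induction_on with
  | empty => simp
  | insert i s hi ih =>
    obtain ⟨h1, h2⟩ := ih fun j hj => h j (Finset.mem_insert_of_mem hj)
    have h3 := h i (Finset.mem_insert_self i s)
    rw [Finset.prod_insert hi, Finset.sum_insert hi, Finset.prod_insert hi]
    refine ⟨natDegree_mul_le.trans (add_le_add h3 h1), ?_⟩
    rw [← h2, coeff_mul_add_eq_of_natDegree_le h3 h1]

theorem det_natDegree_le_and_coeff (M : Matrix (Fin n) (Fin n) ℂ[X]) (β : Fin n → ℕ)
    (h : ∀ a b, (M a b).natDegree ≤ β b) :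
    M.det.natDegree ≤ ∑ i, β i ∧
      M.det.coeff (∑ i, β i) = (Matrix.of fun a b => (M a b).coeff (β b)).det := by
  rw [Matrix.det_apply', Matrix.det_apply']
  have key := fun σ : Equiv.Perm (Fin n) =>
    natDegree_prod_le_and_coeff Finset.univ (fun i => M (σ i) i) β fun i _ => h _ _
  constructor
  · refine natDegree_sum_le_of_forall_le _ _ fun σ _ => ?_
    rw [← C_eq_intCast]
    exact (natDegree_C_mul_le _ _).trans (key σ).1
  · rw [finsetSum_coeff]
    refine Finset.sum_congr rfl fun σ _ => ?_
    rw [← C_eq_intCast, coeff_C_mul, (key σ).2]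
    simp

/-- The mirror image of `wronskianDet_order_zero`, with top coefficients in place of lowest ones. -/
theorem wronskianDet_degree {f : Fin n → ℂ[X]} {β : Fin n → ℕ} (hβ : Function.Injective β)
    (hf : ∀ i, f i ≠ 0) (hfβ : ∀ i, (f i).natDegree = β i) :
    wronskianDet f ≠ 0 ∧
      (wronskianDet f).natDegree + ∑ i : Fin n, (i : ℕ) = ∑ i, β i := by
  obtain ⟨h1, h2⟩ := det_natDegree_le_and_coeff
    (Matrix.of fun a b : Fin n => X ^ (a : ℕ) * derivative^[(a : ℕ)] (f b)) β (by
      intro a b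
      refine natDegree_le_iff_coeff_eq_zero.2 fun N hN => ?_
      rw [Matrix.of_apply, coeff_X_pow_mul_iterate_derivative,
        coeff_eq_zero_of_natDegree_lt (by rw [hfβ]; exact hN), mul_zero])
  simp only [Matrix.of_apply, coeff_X_pow_mul_iterate_derivative] at h2
  have hne := det_lead_ne_zero hβ (c := fun b => (f b).coeff (β b)) fun i => by
    rw [← hfβ]; simpa using hf i
  rw [← h2] at hne
  have hdeg := le_antisymm h1 (le_natDegree_of_ne_zero hne)
  rw [det_X_pow_mul_iterate_derivative] at hdeg hne
  have hw : wronskianDet f ≠ 0 := fun h => hne (by simp [h])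
  rw [natDegree_mul (pow_ne_zero _ X_ne_zero) hw, natDegree_X_pow] at hdeg
  exact ⟨hw, by omega⟩

theorem iterate_derivative_comb (f : Fin n → ℂ[X]) (c : Fin n → ℂ) (a : ℕ) :
    derivative^[a] (∑ i, c i • f i) = ∑ i, derivative^[a] (f i) * C (c i) := by
  rw [iterate_derivative_sum]
  refine Finset.sum_congr rfl fun i _ => ?_
  rw [iterate_derivative_smul, smul_eq_C_mul, mul_comm]

theorem wronskianDet_comb {f g : Fin n → ℂ[X]} {A : Matrix (Fin n) (Fin n) ℂ}
    (h : ∀ b, g b = ∑ c, A c b • f c) : wronskianDet g = wronskianDet f * C A.det := by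
  rw [RingHom.map_det, wronskianDet, wronskianDet, ← Matrix.det_mul]
  congr 1
  ext a b : 2
  rw [Matrix.of_apply, h, iterate_derivative_comb, Matrix.mul_apply]
  rfl

theorem exists_matrix_of_span_eq {f g : Fin n → ℂ[X]} (hg : LinearIndependent ℂ g)
    (h : ∀ b, g b ∈ Submodule.span ℂ (Set.range f)) :
    ∃ A : Matrix (Fin n) (Fin n) ℂ, A.det ≠ 0 ∧ ∀ b, g b = ∑ c, A c b • f c := by
  have h' := fun b => (Submodule.mem_span_range_iff_exists_fun ℂ).1 (h b)
  choose A hA using h'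
  refine ⟨Matrix.of fun c b => A b c, fun hdet => ?_, fun b => (hA b).symm⟩
  obtain ⟨v, hv, hAv⟩ := Matrix.exists_mulVec_eq_zero_iff.2 hdet
  refine hv (funext fun b => Fintype.linearIndependent_iff.1 hg v ?_ b)
  have : ∀ c, ∑ b, A b c * v b = 0 := fun c => congrFun hAv c
  calc ∑ b, v b • g b = ∑ b, ∑ c, (A b c * v b) • f c := by
        refine Finset.sum_congr rfl fun b _ => ?_
        rw [← hA b, Finset.smul_sum]
        refine Finset.sum_congr rfl fun c _ => ?_
        rw [smul_smul, mul_comm]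
    _ = 0 := by
        rw [Finset.sum_comm]
        refine Finset.sum_eq_zero fun c _ => ?_
        rw [← Finset.sum_smul, this, zero_smul]

/-! ### The space of Wronskians with one element omitted -/

/-- The Wronskian determinant of `f`, the row `c` on top. -/
def borderedWronskian (f : Fin (n + 1) → ℂ[X]) (c : Fin (n + 1) → ℂ) : ℂ[X] :=
  (Matrix.of (Fin.cons (fun b => C (c b))
    fun (a : Fin n) b => derivative^[(a : ℕ)] (f b)) : Matrix (Fin (n + 1)) (Fin (n + 1)) ℂ[X]).det

theorem borderedWronskian_eq (f : Fin (n + 1) → ℂ[X]) (c : Fin (n + 1) → ℂ) :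
    borderedWronskian f c =
      ∑ j : Fin (n + 1), ((-1) ^ (j : ℕ) * c j) • wronskianDet (fun b => f (j.succAbove b)) := by
  rw [borderedWronskian, Matrix.det_succ_row_zero]
  refine Finset.sum_congr rfl fun j _ => ?_
  rw [smul_eq_C_mul]
  simp only [Matrix.of_apply, Fin.cons_zero, map_mul, map_pow, map_neg, map_one]
  rfl

/-- The constant row makes a combination of the omitted Wronskians a single determinant, so base
change follows from multiplicativity of `det` without any work with minors. -/
theorem borderedWronskian_comb {f g : Fin (n + 1) → ℂ[X]}
    {A : Matrix (Fin (n + 1)) (Fin (n + 1)) ℂ}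
    (h : ∀ b, g b = ∑ c, A c b • f c) (c : Fin (n + 1) → ℂ) :
    borderedWronskian g (Matrix.vecMul c A) = borderedWronskian f c * C A.det := by
  rw [RingHom.map_det, borderedWronskian, borderedWronskian, ← Matrix.det_mul]
  congr 1
  ext a b : 2
  refine Fin.cases ?_ (fun a => ?_) a
  · simp [Matrix.mul_apply, Matrix.vecMul, dotProduct]
  · rw [Matrix.of_apply, Fin.cons_succ, h, iterate_derivative_comb, Matrix.mul_apply]
    rfl

/-- The span of the Wronskians of the families obtained from `f` by omitting one element. -/
def dualSpan (f : Fin (n + 1) → ℂ[X]) : Submodule ℂ ℂ[X] :=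
  Submodule.span ℂ (Set.range fun j : Fin (n + 1) => wronskianDet fun b => f (j.succAbove b))

theorem borderedWronskian_mem (f : Fin (n + 1) → ℂ[X]) (c : Fin (n + 1) → ℂ) :
    borderedWronskian f c ∈ dualSpan f := by
  rw [borderedWronskian_eq]
  exact Submodule.sum_mem _ fun j _ => Submodule.smul_mem _ _ (Submodule.subset_span ⟨j, rfl⟩)

theorem dualSpan_le {f g : Fin (n + 1) → ℂ[X]} (hg : LinearIndependent ℂ g)
    (h : ∀ b, g b ∈ Submodule.span ℂ (Set.range f)) : dualSpan g ≤ dualSpan f := by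
  obtain ⟨A, hA, hgA⟩ := exists_matrix_of_span_eq hg h
  refine Submodule.span_le.2 ?_
  rintro _ ⟨j, rfl⟩
  -- The entry `(-1)^j` cancels the cofactor sign, so this row yields exactly the Wronskian omitting
  -- `g j`.
  have h1 := borderedWronskian_eq g (Pi.single j ((-1) ^ (j : ℕ)))
  rw [Finset.sum_eq_single j (fun i _ hij => by simp [hij]) (by simp)] at h1
  simp only [Pi.single_eq_same, ← mul_pow, mul_neg, mul_one, neg_neg, one_pow, one_smul] at h1
  have h2 := borderedWronskian_comb hgA (Matrix.vecMul (Pi.single j ((-1) ^ (j : ℕ))) A⁻¹)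
  rw [Matrix.vecMul_vecMul, Matrix.nonsing_inv_mul _ (isUnit_iff_ne_zero.2 hA),
    Matrix.vecMul_one, h1, mul_comm, ← smul_eq_C_mul] at h2
  simp only [SetLike.mem_coe]
  rw [h2]
  exact Submodule.smul_mem _ _ (borderedWronskian_mem _ _)

theorem dualSpan_eq {f g : Fin (n + 1) → ℂ[X]} (hf : LinearIndependent ℂ f)
    (hg : LinearIndependent ℂ g)
    (h : Submodule.span ℂ (Set.range f) = Submodule.span ℂ (Set.range g)) :
    dualSpan f = dualSpan g :=
  le_antisymm (dualSpan_le hf fun b => h ▸ Submodule.subset_span ⟨b, rfl⟩)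
    (dualSpan_le hg fun b => h ▸ Submodule.subset_span ⟨b, rfl⟩)

end Wronskian

/-! ### Polynomials with few terms and a high order of zero at `1` -/

section Moments

theorem coeff_X_mul_derivative (f : ℂ[X]) (n : ℕ) :
    (X * derivative f).coeff n = n * f.coeff n := by
  simpa using coeff_X_pow_mul_iterate_derivative f 1 n

/-- The operator `x d/dx` multiplies the `n`-th coefficient by `n` and costs at most one order of
vanishing at `1`, so the result of `j < M` applications still vanishes at `1`. -/
theorem sum_coeff_mul_pow_eq_zero {S : Finset ℕ} {M : ℕ} {f : ℂ[X]} (hS : f.support ⊆ S)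
    (hf : (X - C 1) ^ M ∣ f) {j : ℕ} (hj : j < M) :
    ∑ n ∈ S, f.coeff n * (n : ℂ) ^ j = 0 := by
  induction j generalizing f M with
  | zero =>
    have h1 : f.eval 1 = 0 := by
      obtain ⟨q, rfl⟩ := (dvd_pow_self (X - C 1 : ℂ[X]) hj.ne').trans hf
      simp
    rw [eval_eq_sum, sum_def] at h1
    rw [← h1]
    simp only [one_pow, pow_zero]
    refine (Finset.sum_subset hS fun n _ hn => ?_).symm
    rw [notMem_support_iff.1 hn, zero_mul]
  | succ j ih =>
    have h2 : (X * derivative f).support ⊆ S := by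
      intro n hn
      refine hS ?_
      rw [mem_support_iff, coeff_X_mul_derivative] at hn
      exact mem_support_iff.2 (right_ne_zero_of_mul hn)
    have := ih h2 ((pow_sub_one_dvd_derivative_of_pow_dvd hf).mul_left X) (by omega)
    rw [← this]
    refine Finset.sum_congr rfl fun n _ => ?_
    rw [coeff_X_mul_derivative]
    ring

theorem sum_coeff_mul_eval_eq_zero {S : Finset ℕ} {M : ℕ} {f : ℂ[X]} (hS : f.support ⊆ S)
    (hf : (X - C 1) ^ M ∣ f) {p : ℂ[X]} (hp : p.natDegree < M) :
    ∑ n ∈ S, f.coeff n * p.eval (n : ℂ) = 0 := by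
  simp_rw [eval_eq_sum_range, Finset.mul_sum]
  rw [Finset.sum_comm]
  refine Finset.sum_eq_zero fun j hj => ?_
  have hj' : j < M := by
    rw [Finset.mem_range] at hj
    omega
  rw [← mul_zero (p.coeff j), ← sum_coeff_mul_pow_eq_zero hS hf hj', Finset.mul_sum]
  refine Finset.sum_congr rfl fun n _ => ?_
  ring

/-- The polynomial with simple roots at the points of `S`. -/
def nodal (S : Finset ℕ) : ℂ[X] := ∏ t ∈ S, (X - C (t : ℂ))

theorem nodal_eval_eq_zero_iff {S : Finset ℕ} {n : ℕ} :
    (nodal S).eval (n : ℂ) = 0 ↔ n ∈ S := by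
  rw [nodal, eval_prod, Finset.prod_eq_zero_iff]
  constructor
  · rintro ⟨t, ht, h⟩
    simp only [eval_sub, eval_X, eval_C, sub_eq_zero, Nat.cast_inj] at h
    exact h ▸ ht
  · exact fun h => ⟨n, h, by simp⟩

/-- The test polynomial with roots at the other `M - 1` points of `S` has degree `< M` and isolates
two terms. Hence the ratio of any two coefficients is forced. -/
theorem coeff_pair {S : Finset ℕ} {M : ℕ} (hM : S.card = M + 1) {f : ℂ[X]} (hS : f.support ⊆ S)
    (hf : (X - C 1) ^ M ∣ f) {n n' : ℕ} (hn : n ∈ S) (hn' : n' ∈ S) (hne : n ≠ n') :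
    f.coeff n * (nodal ((S.erase n).erase n')).eval (n : ℂ) +
      f.coeff n' * (nodal ((S.erase n).erase n')).eval (n' : ℂ) = 0 := by
  have hc : ((S.erase n).erase n').card + 2 = S.card := by
    have h1 := Finset.card_erase_add_one hn
    have h2 := Finset.card_erase_add_one (Finset.mem_erase.2 ⟨hne.symm, hn'⟩)
    omega
  have hdeg : (nodal ((S.erase n).erase n')).natDegree < M := by
    rw [nodal, natDegree_prod_of_monic _ _ fun t _ => monic_X_sub_C _]
    simp only [natDegree_X_sub_C, Finset.sum_const, smul_eq_mul, mul_one]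
    omega
  rw [← sum_coeff_mul_eval_eq_zero hS hf hdeg, ← Finset.sum_subset
    (Finset.insert_subset hn (Finset.singleton_subset_iff.2 hn')) fun t ht ht' => ?_,
    Finset.sum_pair hne]
  simp only [Finset.mem_insert, Finset.mem_singleton, not_or] at ht'
  rw [nodal_eval_eq_zero_iff.2, mul_zero]
  simp [ht, ht']

theorem coeff_ne_zero {S : Finset ℕ} {M : ℕ} (hM : S.card = M + 1) {f : ℂ[X]}
    (hS : f.support ⊆ S) (hf : (X - C 1) ^ M ∣ f) (hf0 : f ≠ 0) {n : ℕ} (hn : n ∈ S) :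
    f.coeff n ≠ 0 := by
  obtain ⟨n', hn'⟩ := Polynomial.support_nonempty.2 hf0
  have hne' := mem_support_iff.1 hn'
  intro h0
  have hne : n ≠ n' := fun h => hne' (h ▸ h0)
  have := coeff_pair hM hS hf hn (hS hn') hne
  rw [h0, zero_mul, zero_add, mul_eq_zero, nodal_eval_eq_zero_iff] at this
  simp [hne'] at this

/-- A shift by one changes only the end factors of a product over an interval. -/
theorem prod_Icc_shift {a b : ℕ} (hab : a ≤ b) (x : ℂ) :
    (x + 1 - a) * ∏ t ∈ Finset.Icc a b, (x - t) =
      (x - b) * ∏ t ∈ Finset.Icc a b, (x + 1 - t) := by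
  induction b, hab using Nat.le_induction with
  | base => simp [mul_comm]
  | succ b hab ih =>
    rw [Finset.prod_Icc_succ_top (by omega), Finset.prod_Icc_succ_top (by omega), ← mul_assoc, ih]
    push_cast
    ring

end Moments

/-! ### Supports that are unions of disjoint intervals -/

section Blocks

variable {r : ℕ} {a b : Fin (r + 1) → ℕ}

/-- The union of the intervals `[a_i, b_i]`. -/
def blocks (a b : Fin (r + 1) → ℕ) : Finset ℕ :=
  Finset.univ.biUnion fun i => Finset.Icc (a i) (b i)

theorem blocks_disjoint (hsep : ∀ i j, i < j → b i < a j) :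
    (Set.univ : Set (Fin (r + 1))).PairwiseDisjoint fun i => Finset.Icc (a i) (b i) := by
  intro i _ j _ hij
  rw [Function.onFun, Finset.disjoint_left]
  intro n hn hn'
  rw [Finset.mem_Icc] at hn hn'
  rcases lt_or_gt_of_ne hij with h | h
  · have := hsep i j h
    omega
  · have := hsep j i h
    omega

theorem card_blocks (hab : ∀ i, a i ≤ b i) (hsep : ∀ i j, i < j → b i < a j) {k : ℕ}
    (hk : ∑ i, b i = ∑ i, a i + k) : (blocks a b).card = r + k + 1 := by
  rw [blocks, Finset.card_biUnion fun i _ j _ hij =>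
    blocks_disjoint hsep (Set.mem_univ i) (Set.mem_univ j) hij]
  have h : ∑ i, (Finset.Icc (a i) (b i)).card + ∑ i, a i = ∑ i, b i + (r + 1) := by
    rw [← Finset.sum_add_distrib]
    have : ∀ i, (Finset.Icc (a i) (b i)).card + a i = b i + 1 := fun i => by
      rw [Nat.card_Icc]
      have := hab i
      omega
    rw [Finset.sum_congr rfl fun i _ => this i, Finset.sum_add_distrib]
    simp
  omega

theorem nodal_blocks_shift (hab : ∀ i, a i ≤ b i) (hsep : ∀ i j, i < j → b i < a j) (x : ℂ) :
    (∏ i, (x + 1 - a i)) * ∏ t ∈ blocks a b, (x - t) =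
      (∏ i, (x - b i)) * ∏ t ∈ blocks a b, (x + 1 - t) := by
  have hd : (↑(Finset.univ : Finset (Fin (r + 1))) : Set _).PairwiseDisjoint
      fun i => Finset.Icc (a i) (b i) := by
    rw [Finset.coe_univ]
    exact blocks_disjoint hsep
  rw [blocks, Finset.prod_biUnion hd, Finset.prod_biUnion hd, ← Finset.prod_mul_distrib,
    ← Finset.prod_mul_distrib]
  exact Finset.prod_congr rfl fun i _ => prod_Icc_shift (hab i) x

/-- Neighbouring coefficients satisfy the hypergeometric recursion. -/
theorem coeff_recursion (hab : ∀ i, a i ≤ b i) (hsep : ∀ i j, i < j → b i < a j) {k : ℕ}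
    (hk : ∑ i, b i = ∑ i, a i + k) {f : ℂ[X]} (hS : f.support ⊆ blocks a b)
    (hf : (X - C 1) ^ (r + k) ∣ f) {n : ℕ} (hn : n ∈ blocks a b) (hn' : n + 1 ∈ blocks a b) :
    f.coeff n * ∏ i, ((n : ℂ) - b i) = f.coeff (n + 1) * ∏ i, ((n : ℂ) + 1 - a i) := by
  have hpair := coeff_pair (card_blocks hab hsep hk) hS hf hn hn' (by omega)
  set p := nodal (((blocks a b).erase n).erase (n + 1)) with hp
  have hN : ∀ x : ℂ, ∏ t ∈ blocks a b, (x - t) = (x - n) * ((x - (n + 1)) * p.eval x) := by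
    intro x
    rw [hp, nodal, eval_prod, ← Finset.mul_prod_erase _ _ hn, ← Finset.mul_prod_erase _ _
      (Finset.mem_erase.2 ⟨by omega, hn'⟩ : n + 1 ∈ (blocks a b).erase n)]
    simp
  -- The shifted nodal identity degenerates to `0 = 0` at `x = n`, so the factor `x - n` is
  -- cancelled as a polynomial before evaluation there.
  have hpoly : (∏ i, (X + 1 - C (a i : ℂ))) * ((X - C ((n : ℂ) + 1)) * p) =
      (∏ i, (X - C (b i : ℂ))) * ((X + 1 - C (n : ℂ)) * p.comp (X + 1)) := by
    have hX : (X - C (n : ℂ)) ≠ 0 := X_sub_C_ne_zero _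
    refine mul_left_cancel₀ hX (Polynomial.funext fun x => ?_)
    have h1 := nodal_blocks_shift hab hsep x
    have h2 := hN (x + 1)
    have h3 : ∏ t ∈ blocks a b, (x + 1 - (t : ℂ)) =
      (x + 1 - n) * ((x + 1 - (n + 1)) * p.eval (x + 1)) := h2
    rw [hN, h3] at h1
    simp only [eval_mul, eval_prod, eval_sub, eval_add, eval_X, eval_one, eval_C, eval_comp]
    linear_combination h1
  have h4 := congrArg (eval (n : ℂ)) hpoly
  simp only [eval_mul, eval_prod, eval_sub, eval_add, eval_X, eval_one, eval_C, eval_comp] at h4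
  have hp0 : p.eval ((n : ℂ) + 1) ≠ 0 := by
    have := (nodal_eval_eq_zero_iff (S := ((blocks a b).erase n).erase (n + 1))
      (n := n + 1)).not.2 (by simp)
    simpa using this
  push_cast at hpair
  refine mul_right_cancel₀ hp0 ?_
  linear_combination (-f.coeff n) * h4 - (∏ i, ((n : ℂ) + 1 - a i)) * hpair

theorem coeff_comb_of_mem (hsep : ∀ i j, i < j → b i < a j) {f : Fin (r + 1) → ℂ[X]}
    (hf : ∀ i, (f i).support ⊆ Finset.Icc (a i) (b i)) (c : Fin (r + 1) → ℂ) {i : Fin (r + 1)}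
    {n : ℕ} (hn : n ∈ Finset.Icc (a i) (b i)) :
    (∑ j, c j • f j).coeff n = c i * (f i).coeff n := by
  rw [finsetSum_coeff, Finset.sum_eq_single i (fun j _ hji => ?_) (by simp)]
  · simp
  · have : n ∉ (f j).support := fun h => Finset.disjoint_left.1
      (blocks_disjoint hsep (Set.mem_univ j) (Set.mem_univ i) hji) (hf j h) hn
    simp [notMem_support_iff.1 this]

theorem support_comb {f : Fin (r + 1) → ℂ[X]}
    (hf : ∀ i, (f i).support ⊆ Finset.Icc (a i) (b i)) (c : Fin (r + 1) → ℂ) :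
    (∑ j, c j • f j).support ⊆ blocks a b := by
  intro n hn
  by_contra h
  rw [mem_support_iff, finsetSum_coeff] at hn
  refine hn (Finset.sum_eq_zero fun j _ => ?_)
  have : n ∉ (f j).support := fun hj => h (Finset.mem_biUnion.2 ⟨j, Finset.mem_univ j, hf j hj⟩)
  simp [notMem_support_iff.1 this]

/-- If the span of polynomials supported on the blocks contains a nonzero polynomial that vanishes
at `1` to the order `r + k`, these polynomials satisfy the hypergeometric recursion. -/
theorem block_recursion (hab : ∀ i, a i ≤ b i) (hsep : ∀ i j, i < j → b i < a j) {k : ℕ}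
    (hk : ∑ i, b i = ∑ i, a i + k) {f : Fin (r + 1) → ℂ[X]}
    (hf : ∀ i, (f i).support ⊆ Finset.Icc (a i) (b i)) {g : ℂ[X]}
    (hg : g ∈ Submodule.span ℂ (Set.range f)) (hg0 : g ≠ 0) (hg1 : (X - C 1) ^ (r + k) ∣ g)
    (i : Fin (r + 1)) {n : ℕ} (hn : a i ≤ n) (hn' : n < b i) :
    (f i).coeff n * ∏ i, ((n : ℂ) - b i) = (f i).coeff (n + 1) * ∏ i, ((n : ℂ) + 1 - a i) := by
  obtain ⟨c, rfl⟩ := (Submodule.mem_span_range_iff_exists_fun ℂ).1 hg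
  have hm : n ∈ Finset.Icc (a i) (b i) := Finset.mem_Icc.2 ⟨hn, hn'.le⟩
  have hm' : n + 1 ∈ Finset.Icc (a i) (b i) := Finset.mem_Icc.2 ⟨by omega, by omega⟩
  have hsub : Finset.Icc (a i) (b i) ⊆ blocks a b :=
    Finset.subset_biUnion_of_mem (fun i => Finset.Icc (a i) (b i)) (Finset.mem_univ i)
  -- No coefficient of the combination vanishes on the blocks, hence `c i ≠ 0`, and the recursion
  -- for the combination can be divided by `c i`.
  have hne := coeff_ne_zero (card_blocks hab hsep hk) (support_comb hf c) hg1 hg0 (hsub hm)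
  have h := coeff_recursion hab hsep hk (support_comb hf c) hg1 (hsub hm) (hsub hm')
  rw [coeff_comb_of_mem hsep hf c hm] at h hne
  rw [coeff_comb_of_mem hsep hf c hm', mul_assoc, mul_assoc] at h
  exact mul_left_cancel₀ (left_ne_zero_of_mul hne) h

/-- Divisibility by `(x - 1)^M` imposes `M` linear conditions on `M + 1` coefficients. -/
theorem exists_block_polynomial {S : Finset ℕ} {M : ℕ} (hM : S.card = M + 1) :
    ∃ g : ℂ[X], g ≠ 0 ∧ g.support ⊆ S ∧ (X - C 1) ^ M ∣ g := by
  let E : (S → ℂ) →ₗ[ℂ] ℂ[X] := ∑ n : S, (monomial (n : ℕ)).comp (LinearMap.proj n)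
  have hE : ∀ c m, (E c).coeff m = ∑ n : S, if (n : ℕ) = m then c n else 0 := fun c m => by
    simp [E, LinearMap.sum_apply, finsetSum_coeff, coeff_monomial]
  let L : (S → ℂ) →ₗ[ℂ] (Fin M → ℂ) := LinearMap.pi fun j => (taylorCoeff 1 j).comp E
  have hker : LinearMap.ker L ≠ ⊥ := by
    apply LinearMap.ker_ne_bot_of_finrank_lt
    simp [hM]
  obtain ⟨c, hc, hc0⟩ := (Submodule.ne_bot_iff _).1 hker
  have hcoeff : ∀ n : S, (E c).coeff n = c n := fun n => by
    rw [hE, Finset.sum_eq_single n (fun t _ ht => if_neg fun h => ht (Subtype.ext h)) (by simp)]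
    simp
  refine ⟨E c, fun h => hc0 (funext fun n => ?_), fun n hn => ?_, ?_⟩
  · rw [← hcoeff, h]
    rfl
  · by_contra hnS
    rw [mem_support_iff, hE] at hn
    exact hn (Finset.sum_eq_zero fun t _ => if_neg fun h : (t : ℕ) = n => hnS (h ▸ t.2))
  · rw [X_sub_C_pow_dvd_iff_taylor, X_pow_dvd_iff]
    intro d hd
    exact congrFun (LinearMap.mem_ker.1 hc) ⟨d, hd⟩

end Blocks

/-! ### Spaces spanned by block polynomials -/

section BlockSpaces

variable {r : ℕ} {a b : Fin (r + 1) → ℕ}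

theorem rootMultiplicity_zero_eq_iff {f : ℂ[X]} {n : ℕ} :
    (f ≠ 0 ∧ f.rootMultiplicity 0 = n) ↔ f.coeff n ≠ 0 ∧ ∀ m < n, f.coeff m = 0 := by
  rw [← isLead_taylorCoeff_iff]
  simp [IsLead, taylorCoeff_apply]

/-- The `f i` are the restrictions of one polynomial `g` to the blocks. Their orders and degrees are
exact because `g` has no zero coefficient on any block. -/
theorem exists_block_basis (hab : ∀ i, a i ≤ b i) (hsep : ∀ i j, i < j → b i < a j) {k : ℕ}
    (hk : ∑ i, b i = ∑ i, a i + k) :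
    ∃ f : Fin (r + 1) → ℂ[X],
      (∀ i, f i ≠ 0 ∧ (f i).rootMultiplicity 0 = a i ∧ (f i).natDegree = b i) ∧
      ∃ g ∈ Submodule.span ℂ (Set.range f), g ≠ 0 ∧ (X - C 1) ^ (r + k) ∣ g := by
  obtain ⟨g, hg0, hgS, hg1⟩ := exists_block_polynomial (card_blocks hab hsep hk)
  have hne : ∀ n ∈ blocks a b, g.coeff n ≠ 0 := fun n hn =>
    coeff_ne_zero (card_blocks hab hsep hk) hgS hg1 hg0 hn
  have hsub : ∀ i, Finset.Icc (a i) (b i) ⊆ blocks a b := fun i =>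
    Finset.subset_biUnion_of_mem (fun i => Finset.Icc (a i) (b i)) (Finset.mem_univ i)
  let f : Fin (r + 1) → ℂ[X] := fun i => ∑ n ∈ Finset.Icc (a i) (b i), monomial n (g.coeff n)
  have hf : ∀ i n, (f i).coeff n = if n ∈ Finset.Icc (a i) (b i) then g.coeff n else 0 := by
    intro i n
    simp [f, finsetSum_coeff, coeff_monomial]
  have hfa : ∀ i, f i ≠ 0 ∧ (f i).rootMultiplicity 0 = a i := fun i => by
    rw [rootMultiplicity_zero_eq_iff]
    have hmem : a i ∈ Finset.Icc (a i) (b i) := Finset.left_mem_Icc.2 (hab i)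
    refine ⟨?_, fun m hm => ?_⟩
    · rw [hf, if_pos hmem]
      exact hne _ (hsub i hmem)
    · rw [hf, if_neg fun h => by have := (Finset.mem_Icc.1 h).1; omega]
  have hfb : ∀ i, (f i).natDegree = b i := fun i => by
    refine le_antisymm (natDegree_le_iff_coeff_eq_zero.2 fun N hN => ?_)
      (le_natDegree_of_ne_zero ?_)
    · rw [hf, if_neg fun h => by have := (Finset.mem_Icc.1 h).2; omega]
    · have hmem : b i ∈ Finset.Icc (a i) (b i) := Finset.right_mem_Icc.2 (hab i)
      rw [hf, if_pos hmem]
      exact hne _ (hsub i hmem)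
  refine ⟨f, fun i => ⟨(hfa i).1, (hfa i).2, hfb i⟩, g, ?_, hg0, hg1⟩
  have : g = ∑ i, f i := by
    have hd : (↑(Finset.univ : Finset (Fin (r + 1))) : Set _).PairwiseDisjoint
        fun i => Finset.Icc (a i) (b i) := by
      rw [Finset.coe_univ]
      exact blocks_disjoint hsep
    rw [← Finset.sum_biUnion hd]
    conv_lhs => rw [g.as_sum_support]
    refine Finset.sum_subset hgS fun n _ hn => ?_
    rw [notMem_support_iff.1 hn, map_zero]
  rw [this]
  exact Submodule.sum_mem _ fun i _ => Submodule.subset_span ⟨i, rfl⟩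

theorem le_of_strictMono_fin {n : ℕ} {α : Fin n → ℕ} (hα : StrictMono α) (i : Fin n) :
    (i : ℕ) ≤ α i := by
  obtain ⟨i, hi⟩ := i
  induction i with
  | zero => simp
  | succ i ih =>
    have h1 := ih (by omega)
    have h2 : α ⟨i, by omega⟩ < α ⟨i + 1, hi⟩ := hα (by simp)
    simp only at h1 ⊢
    omega

/-- The order of zero of a Wronskian in terms of the exponents of the span. -/
theorem exists_exponents_wronskianDet {f : Fin (r + 1) → ℂ[X]} (hli : LinearIndependent ℂ f)
    (z : ℂ) :
    ∃ α : Fin (r + 1) → ℕ, StrictMono α ∧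
      exponentsAt (Submodule.span ℂ (Set.range f)) z = Set.range α ∧
      (wronskianDet f).rootMultiplicity z + ∑ i : Fin (r + 1), (i : ℕ) = ∑ i, α i := by
  obtain ⟨α, g, hα, hg, hspan⟩ := exists_adapted_basis
    (W := Submodule.span ℂ (Set.range f)) (by rw [finrank_span_eq_card hli, Fintype.card_fin]) z
  have hlig := linearIndependent_of_rootMultiplicity z hα.injective (fun i => (hg i).1)
    fun i => (hg i).2
  refine ⟨α, hα, ?_, ?_⟩
  · rw [← hspan]
    exact exponentsAt_span z hα.injective (fun i => (hg i).1) fun i => (hg i).2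
  · obtain ⟨A, hA, hgA⟩ := exists_matrix_of_span_eq (f := f) hlig fun b => by
      rw [← hspan]
      exact Submodule.subset_span ⟨b, rfl⟩
    have hw := wronskianDet_comb hgA
    obtain ⟨h0, h⟩ := wronskianDet_order z hα.injective (fun i => (hg i).1) fun i => (hg i).2
    rw [hw] at h h0
    rwa [rootMultiplicity_mul h0, rootMultiplicity_C, add_zero] at h

theorem sum_rootMultiplicity_le {p : ℂ[X]} (hp : p ≠ 0) (s : Finset ℂ) :
    ∑ z ∈ s, p.rootMultiplicity z ≤ p.natDegree := by
  have hdvd : ∏ z ∈ s, (X - C z) ^ p.rootMultiplicity z ∣ p := by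
    refine Finset.prod_dvd_of_coprime (fun z _ w _ hzw => ?_) fun z _ => pow_rootMultiplicity_dvd p z
    exact (pairwise_coprime_X_sub_C Function.injective_id hzw).pow
  have := natDegree_le_of_dvd hdvd hp
  rwa [natDegree_prod_of_monic _ _ fun z _ => (monic_X_sub_C z).pow _,
    Finset.sum_congr rfl fun z _ => by rw [natDegree_pow, natDegree_X_sub_C, mul_one]] at this

/-- The Wronskian has degree minus order at `0` equal to `k`, while the element `g` forces order at
least `k` at `1`. Nothing is left for other points, and the termwise lower bounds on the exponents
must be equalities. -/
theorem exponents_block_space {k : ℕ} (ha : Function.Injective a)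
    (hb : Function.Injective b)
    (hk : ∑ i, b i = ∑ i, a i + k) {f : Fin (r + 1) → ℂ[X]}
    (hf : ∀ i, f i ≠ 0 ∧ (f i).rootMultiplicity 0 = a i ∧ (f i).natDegree = b i)
    {g : ℂ[X]} (hg : g ∈ Submodule.span ℂ (Set.range f)) (hg0 : g ≠ 0)
    (hg1 : (X - C 1) ^ (r + k) ∣ g) :
    (exponentsAt (Submodule.span ℂ (Set.range f)) 1 =
      Set.range fun i : Fin (r + 1) => (i : ℕ) + if (i : ℕ) = r then k else 0) ∧
    ∀ z : ℂ, z ≠ 0 → z ≠ 1 → exponentsAt (Submodule.span ℂ (Set.range f)) z =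
      Set.range fun i : Fin (r + 1) => (i : ℕ) := by
  have hli := linearIndependent_of_natDegree hb (fun i => (hf i).1) fun i => (hf i).2.2
  obtain ⟨hw, h0⟩ := wronskianDet_order 0 ha (fun i => (hf i).1) fun i => (hf i).2.1
  have hinf := (wronskianDet_degree hb (fun i => (hf i).1) fun i => (hf i).2.2).2
  obtain ⟨α, hα, hexp, hord⟩ := exists_exponents_wronskianDet hli 1
  have hle := le_of_strictMono_fin hα
  have hlast : r + k ≤ α (Fin.last r) := by
    have : g.rootMultiplicity 1 ∈ Set.range α := hexp ▸ ⟨g, hg, hg0, rfl⟩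
    obtain ⟨j, hj⟩ := this
    calc r + k ≤ g.rootMultiplicity 1 := (le_rootMultiplicity_iff hg0).2 hg1
      _ = α j := hj.symm
      _ ≤ α (Fin.last r) := hα.monotone (Fin.le_last j)
  have hle' : ∀ i : Fin (r + 1), (i : ℕ) + (if (i : ℕ) = r then k else 0) ≤ α i := fun i => by
    split_ifs with h
    · have : i = Fin.last r := Fin.ext h
      rw [this]
      simpa using hlast
    · exact hle i
  have hsum : ∑ i : Fin (r + 1), ((i : ℕ) + if (i : ℕ) = r then k else 0) =
      ∑ i : Fin (r + 1), (i : ℕ) + k := by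
    rw [Finset.sum_add_distrib]
    congr 1
    rw [Finset.sum_eq_single (Fin.last r)]
    · simp
    · intro i _ hi
      exact if_neg fun h => hi (Fin.ext h)
    · simp
  have h1 : k ≤ (wronskianDet f).rootMultiplicity 1 := by
    have := Finset.sum_le_sum fun i (_ : i ∈ Finset.univ) => hle' i
    omega
  have hz : ∀ z : ℂ, z ≠ 0 → z ≠ 1 → (wronskianDet f).rootMultiplicity 0 +
      ((wronskianDet f).rootMultiplicity 1 + (wronskianDet f).rootMultiplicity z) ≤
      (wronskianDet f).natDegree := fun z hz0 hz1 => by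
    have := sum_rootMultiplicity_le hw {0, 1, z}
    rwa [Finset.sum_insert (by simp [hz0.symm]), Finset.sum_insert (by simp [hz1.symm]),
      Finset.sum_singleton] at this
  constructor
  · rw [hexp]
    congr 1
    -- Any third point would do; only the inequality for `0` and `1` is needed.
    have h2 := hz 2 two_ne_zero (by norm_num)
    have := (Finset.sum_eq_sum_iff_of_le fun i (_ : i ∈ Finset.univ) => hle' i).1 (by omega)
    exact funext fun i => (this i (Finset.mem_univ i)).symm
  · intro z hz0 hz1
    have h2 := hz z hz0 hz1
    obtain ⟨β, hβ, hexpβ, hordβ⟩ := exists_exponents_wronskianDet hli z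
    rw [hexpβ]
    congr 1
    have := (Finset.sum_eq_sum_iff_of_le fun i (_ : i ∈ Finset.univ) =>
      le_of_strictMono_fin hβ i).1 (by omega)
    exact funext fun i => (this i (Finset.mem_univ i)).symm

/-- Impose `r` conditions: vanishing coefficients at `a j` for `j < i` and at `b j` for `j > i`. A
nonzero solution has order `a j` with `j ≥ i` and degree `b j'` with `j' ≤ i`, and the separation of
the blocks leaves only `j = j' = i`. -/
theorem exists_mem_of_exponents (hsep : ∀ i j, i < j → b i < a j)
    {W : Submodule ℂ ℂ[X]} (hW : Module.finrank ℂ W = r + 1)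
    (h0 : exponentsAt W 0 = Set.range a) (hinf : exponentsAtInfty W = Set.range b)
    (i : Fin (r + 1)) :
    ∃ f ∈ W, f.Monic ∧ f.rootMultiplicity 0 = a i ∧ f.natDegree = b i := by
  have : FiniteDimensional ℂ W := Module.finite_of_finrank_pos (by omega)
  let L : W →ₗ[ℂ] (Fin r → ℂ) := LinearMap.pi fun j =>
    (lcoeff ℂ (if i.succAbove j < i then a (i.succAbove j) else b (i.succAbove j))).comp W.subtype
  have hker : LinearMap.ker L ≠ ⊥ := by
    apply LinearMap.ker_ne_bot_of_finrank_lt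
    simp [hW]
  obtain ⟨f, hf, hf0⟩ := (Submodule.ne_bot_iff _).1 hker
  have hf0' : (f : ℂ[X]) ≠ 0 := fun h => hf0 (Subtype.ext h)
  have hcoeff : ∀ j, j ≠ i → (f : ℂ[X]).coeff (if j < i then a j else b j) = 0 := fun j hj => by
    obtain ⟨j, rfl⟩ := Fin.exists_succAbove_eq hj
    exact congrFun (LinearMap.mem_ker.1 hf) j
  obtain ⟨j, hj⟩ : (f : ℂ[X]).rootMultiplicity 0 ∈ Set.range a := h0 ▸ ⟨f, f.2, hf0', rfl⟩
  obtain ⟨j', hj'⟩ : (f : ℂ[X]).natDegree ∈ Set.range b := hinf ▸ ⟨f, f.2, hf0', rfl⟩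
  have hij : i ≤ j := by
    by_contra! h
    have := hcoeff j h.ne
    rw [if_pos h, hj] at this
    exact (rootMultiplicity_zero_eq_iff.1 ⟨hf0', rfl⟩).1 this
  have hij' : j' ≤ i := by
    by_contra! h
    have := hcoeff j' h.ne'
    rw [if_neg h.le.not_gt, hj'] at this
    exact hf0' (leadingCoeff_eq_zero.1 this)
  have hle : a j ≤ b j' := by
    rw [hj, hj']
    have := (rootMultiplicity_zero_eq_iff.1 ⟨hf0', rfl⟩).1
    exact le_natDegree_of_ne_zero this
  have hjj : j ≤ j' := by
    by_contra! h
    have := hsep j' j h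
    omega
  obtain rfl : i = j := le_antisymm hij (hjj.trans hij')
  obtain rfl : i = j' := le_antisymm hjj hij'
  have hc : ((f : ℂ[X]).leadingCoeff)⁻¹ ≠ 0 := inv_ne_zero (leadingCoeff_ne_zero.2 hf0')
  refine ⟨((f : ℂ[X]).leadingCoeff)⁻¹ • (f : ℂ[X]), W.smul_mem _ f.2, ?_, ?_, ?_⟩
  · rw [smul_eq_C_mul]
    refine monic_C_mul_of_mul_leadingCoeff_eq_one ?_
    exact inv_mul_cancel₀ (leadingCoeff_ne_zero.2 hf0')
  · rw [smul_eq_C_mul, rootMultiplicity_mul (mul_ne_zero (C_ne_zero.2 hc) hf0'),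
      rootMultiplicity_C, zero_add, hj]
  · rw [natDegree_smul _ hc, hj']

end BlockSpaces

/-! ### Blocks attached to consistent `m, l, k`, and the space `U` -/

section Parameters

variable {r : ℕ} {m l : Fin r → ℕ} {k : ℕ}

theorem extL_succ_last {R : Type*} [Zero R] (k : R) (l : Fin r → R) : extL k l (r + 1) = 0 := by
  simp [extL, entry]

theorem gap_add_extL (h : IsPartitionBelow l k) {i : ℕ} (hi : i ≤ r) :
    gap k l i + extL k l (i + 1) = extL k l i :=
  Nat.sub_add_cancel (h i hi)

theorem sum_gap_add_extL (h : IsPartitionBelow l k) {n : ℕ} (hn : n ≤ r + 1) :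
    ∑ i ∈ Finset.range n, gap k l i + extL k l n = k := by
  induction n with
  | zero => simp [extL]
  | succ n ih =>
    rw [Finset.sum_range_succ, add_assoc, gap_add_extL h (by omega), ih (by omega)]

theorem sum_gap (h : IsPartitionBelow l k) : ∑ i ∈ Finset.range (r + 1), gap k l i = k := by
  have := sum_gap_add_extL h le_rfl
  rwa [extL_succ_last, add_zero] at this

theorem sum_gap_rev (h : IsPartitionBelow l k) :
    ∑ i : Fin (r + 1), gap k l (r - (i : ℕ)) = k := by
  have := Finset.sum_range_reflect (gap k l) (r + 1)
  rw [sum_gap h, Nat.add_sub_cancel] at this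
  rw [Fin.sum_univ_eq_sum_range fun i => gap k l (r - i), this]

theorem gap_le (h : IsPartitionBelow l k) {i : ℕ} (hi : i ≤ r) : gap k l i ≤ k :=
  (Finset.single_le_sum (f := gap k l) (fun _ _ => Nat.zero_le _)
    (Finset.mem_range.2 (Nat.lt_succ_of_le hi))).trans_eq (sum_gap h)

theorem gap_le_entry (h : Consistent m l k) {i : ℕ} (hi : 1 ≤ i) (hir : i ≤ r) :
    gap k l i ≤ entry m i := by
  have h1 := h.2 i hi hir
  have h2 := gap_add_extL h.1 hir
  omega

/-- `m_1 + … + m_i + i` for natural numbers. -/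
def natLowSum (m : Fin r → ℕ) (i : ℕ) : ℕ := i + ∑ s ∈ Finset.Icc 1 i, entry m s

theorem natLowSum_succ (m : Fin r → ℕ) (i : ℕ) :
    natLowSum m (i + 1) = natLowSum m i + entry m (i + 1) + 1 := by
  rw [natLowSum, natLowSum, Finset.sum_Icc_succ_top (by omega)]
  ring

theorem natLowSum_strictMono (m : Fin r → ℕ) : StrictMono (natLowSum m) :=
  strictMono_nat_of_lt_succ fun i => by
    rw [natLowSum_succ]
    omega

theorem ordU_add_natLowSum (m : Fin r → ℕ) {i : ℕ} (hi : i ≤ r) :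
    ordU m i + natLowSum m (r - i) = natLowSum m r := by
  induction i with
  | zero => simp [ordU]
  | succ i ih =>
    rw [← ih (by omega), show r - i = (r - (i + 1)) + 1 by omega, natLowSum_succ, ordU, ordU,
      show r + 1 - (i + 1) = r - i by omega, ← Finset.sum_erase_add _ _
      (Finset.left_mem_Icc.2 (by omega : r - i ≤ r)), Finset.Icc_erase_left,
      show r + 1 - i = r - i + 1 by omega, show r - (i + 1) + 1 = r - i by omega]
    have : Finset.Icc (r - i + 1) r = Finset.Ioc (r - i) r := by
      ext
      simp
    rw [this]
    ring

/-- Consistency keeps the blocks apart: block `i` has length `l_{r-i} - l_{r-i+1} ≤ m_{r-i}`, and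
the next one starts `m_{r-i} + 1` after the start of block `i`. -/
theorem expU_lt_ordU (h : Consistent m l k) {i j : ℕ} (hij : i < j) (hj : j ≤ r) :
    expU m l k i < ordU m j := by
  have h1 := ordU_add_natLowSum m (i := i) (by omega)
  have h2 := ordU_add_natLowSum m hj
  have h3 := gap_le_entry h (i := r - i) (by omega) (by omega)
  have h4 := natLowSum_succ m (r - i - 1)
  have h5 : natLowSum m (r - j) ≤ natLowSum m (r - i - 1) :=
    (natLowSum_strictMono m).monotone (by omega)
  rw [show r - i - 1 + 1 = r - i by omega] at h4
  unfold expU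
  omega

theorem ordU_le_expU (m l : Fin r → ℕ) (k i : ℕ) : ordU m i ≤ expU m l k i := Nat.le_add_right _ _

theorem sum_expU (h : IsPartitionBelow l k) :
    ∑ i : Fin (r + 1), expU m l k i = ∑ i : Fin (r + 1), ordU m i + k := by
  simp only [expU]
  rw [Finset.sum_add_distrib, sum_gap_rev h]

theorem expSet_eq_range (r : ℕ) (n : ℕ → ℕ) :
    expSet r n = Set.range fun j : Fin (r + 1) => (j : ℕ) + ∑ s ∈ Finset.Icc 1 (j : ℕ), n s := by
  ext a
  constructor
  · rintro ⟨j, hj, rfl⟩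
    exact ⟨⟨j, by omega⟩, rfl⟩
  · rintro ⟨j, rfl⟩
    exact ⟨j, by omega, rfl⟩

theorem setOf_exists_le_eq_range (r : ℕ) (e : ℕ → ℕ) :
    {a | ∃ i ≤ r, a = e i} = Set.range fun j : Fin (r + 1) => e j := by
  ext a
  constructor
  · rintro ⟨j, hj, rfl⟩
    exact ⟨⟨j, by omega⟩, rfl⟩
  · rintro ⟨j, rfl⟩
    exact ⟨j, by omega, rfl⟩

theorem sum_entry_reflect (m : Fin r → ℕ) {j : ℕ} (hj : j ≤ r) :
    j + ∑ s ∈ Finset.Icc 1 j, entry m (r + 1 - s) = ordU m j := by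
  rw [ordU, add_comm]
  congr 1
  refine Finset.sum_nbij' (fun s => r + 1 - s) (fun s => r + 1 - s) ?_ ?_ ?_ ?_ ?_
  all_goals intro s hs
  all_goals rw [Finset.mem_Icc] at hs
  · rw [Finset.mem_Icc]
    omega
  · rw [Finset.mem_Icc]
    omega
  · omega
  · omega

theorem isSpaceU_iff (hr : 1 ≤ r) {U : Submodule ℂ ℂ[X]} :
    IsSpaceU m l k U ↔ Module.finrank ℂ U = r + 1 ∧
      exponentsAt U 0 = (Set.range fun j : Fin (r + 1) => ordU m j) ∧
      exponentsAt U 1 = (Set.range fun j : Fin (r + 1) => (j : ℕ) + if (j : ℕ) = r then k else 0) ∧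
      (∀ z : ℂ, z ≠ 0 → z ≠ 1 → exponentsAt U z = Set.range fun j : Fin (r + 1) => (j : ℕ)) ∧
      exponentsAtInfty U = (Set.range fun j : Fin (r + 1) => expU m l k j) := by
  have h0 : expSet r (fun s => entry m (r + 1 - s)) =
      Set.range fun j : Fin (r + 1) => ordU m j := by
    rw [expSet_eq_range]
    congr 1
    funext j
    exact sum_entry_reflect m (by omega)
  have h1 : expSet r (fun s => if s = r then k else 0) =
      Set.range fun j : Fin (r + 1) => (j : ℕ) + if (j : ℕ) = r then k else 0 := by
    rw [expSet_eq_range]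
    congr 1
    funext j
    rw [Finset.sum_ite_eq']
    congr 1
    exact if_congr (by rw [Finset.mem_Icc]; omega) rfl rfl
  have hz : expSet r (fun _ => 0) = Set.range fun j : Fin (r + 1) => (j : ℕ) := by
    rw [expSet_eq_range]
    simp
  have hinf := setOf_exists_le_eq_range r (expU m l k)
  constructor
  · rintro ⟨a, b, c, d, e⟩
    exact ⟨a, b.trans h0, c.trans h1, fun z z0 z1 => (d z z0 z1).trans hz, e.trans hinf⟩
  · rintro ⟨a, b, c, d, e⟩
    exact ⟨a, b.trans h0.symm, c.trans h1.symm, fun z z0 z1 => (d z z0 z1).trans hz.symm,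
      e.trans hinf.symm⟩

theorem isSpaceV_iff {V : Submodule ℂ ℂ[X]} :
    IsSpaceV m l k V ↔ Module.finrank ℂ V = r + 1 ∧
      exponentsAt V 0 = (Set.range fun j : Fin (r + 1) => natLowSum m j) ∧
      exponentsAt V 1 = (Set.range fun j : Fin (r + 1) => (j : ℕ) + if (j : ℕ) = 0 then 0 else k) ∧
      (∀ z : ℂ, z ≠ 0 → z ≠ 1 → exponentsAt V z = Set.range fun j : Fin (r + 1) => (j : ℕ)) ∧
      exponentsAtInfty V = (Set.range fun j : Fin (r + 1) => expV m l k j) := by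
  have h0 : expSet r (fun s => entry m s) =
      Set.range fun j : Fin (r + 1) => natLowSum m j := expSet_eq_range _ _
  have h1 : expSet r (fun s => if s = 1 then k else 0) =
      Set.range fun j : Fin (r + 1) => (j : ℕ) + if (j : ℕ) = 0 then 0 else k := by
    rw [expSet_eq_range]
    congr 1
    funext j
    rw [Finset.sum_ite_eq', ← ite_not]
    congr 1
    exact if_congr (by rw [Finset.mem_Icc]; omega) rfl rfl
  have hz : expSet r (fun _ => 0) = Set.range fun j : Fin (r + 1) => (j : ℕ) := by
    rw [expSet_eq_range]
    simp
  have hinf := setOf_exists_le_eq_range r (expV m l k)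
  constructor
  · rintro ⟨a, b, c, d, e⟩
    exact ⟨a, b.trans h0, c.trans h1, fun z z0 z1 => (d z z0 z1).trans hz, e.trans hinf⟩
  · rintro ⟨a, b, c, d, e⟩
    exact ⟨a, b.trans h0.symm, c.trans h1.symm, fun z z0 z1 => (d z z0 z1).trans hz.symm,
      e.trans hinf.symm⟩

theorem ordU_strictMono (m : Fin r → ℕ) : StrictMono fun i : Fin (r + 1) => ordU m i := by
  intro i j hij
  have h1 := ordU_add_natLowSum m (i := i) (by omega)
  have h2 := ordU_add_natLowSum m (i := j) (by omega)
  have h3 := natLowSum_strictMono m (show r - (j : ℕ) < r - (i : ℕ) by omega)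
  simp only
  omega

theorem expU_strictMono (h : Consistent m l k) :
    StrictMono fun i : Fin (r + 1) => expU m l k i := fun i j hij =>
  (expU_lt_ordU h hij (by omega)).trans_le (ordU_le_expU m l k j)

theorem exists_isSpaceU (hr : 1 ≤ r) (h : Consistent m l k) :
    ∃ U : Submodule ℂ ℂ[X], IsSpaceU m l k U := by
  obtain ⟨f, hf, g, hg, hg0, hg1⟩ := exists_block_basis
    (a := fun i : Fin (r + 1) => ordU m i) (b := fun i : Fin (r + 1) => expU m l k i)
    (fun i => ordU_le_expU m l k i) (fun i j hij => expU_lt_ordU h hij (by omega)) (sum_expU h.1)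
  have ha := (ordU_strictMono m).injective
  have hb := (expU_strictMono h).injective
  obtain ⟨h1, hz⟩ := exponents_block_space ha hb (sum_expU h.1) hf hg hg0 hg1
  refine ⟨Submodule.span ℂ (Set.range f), (isSpaceU_iff hr).2 ⟨?_, ?_, h1, hz, ?_⟩⟩
  · rw [finrank_span_eq_card (linearIndependent_of_natDegree hb (fun i => (hf i).1)
      fun i => (hf i).2.2), Fintype.card_fin]
  · exact exponentsAt_span 0 ha (fun i => (hf i).1) fun i => (hf i).2.1
  · exact exponentsAtInfty_span hb (fun i => (hf i).1) fun i => (hf i).2.2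

theorem exists_isUBasis (hr : 1 ≤ r) (h : Consistent m l k) {U : Submodule ℂ ℂ[X]}
    (hU : IsSpaceU m l k U) : ∃ u, IsUBasis m l k U u := by
  obtain ⟨hdim, h0, -, -, hinf⟩ := (isSpaceU_iff hr).1 hU
  have hex := exists_mem_of_exponents (a := fun i : Fin (r + 1) => ordU m i)
    (b := fun i : Fin (r + 1) => expU m l k i)
    (fun i j hij => expU_lt_ordU h hij (by omega)) hdim h0 hinf
  choose f hfU hfm hfa hfb using hex
  have hdvd : ∀ i, ∃ q, f i = q * X ^ ordU m (i : ℕ) := fun i => by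
    obtain ⟨q, hq⟩ := pow_rootMultiplicity_dvd (f i) 0
    refine ⟨q, ?_⟩
    rw [hfa] at hq
    rw [hq]
    simp [mul_comm]
  choose u hu using hdvd
  have hum : ∀ i, (u i).Monic := fun i => (monic_X_pow (ordU m (i : ℕ))).of_mul_monic_right
    (by rw [← hu]; exact hfm i)
  have hli := linearIndependent_of_natDegree (expU_strictMono h).injective
    (fun i => (hfm i).ne_zero) hfb
  have hfun : (fun i : Fin (r + 1) => u i * X ^ ordU m (i : ℕ)) = f :=
    funext fun i => (hu i).symm
  refine ⟨u, fun i => ⟨hum i, ?_⟩, ?_, ?_⟩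
  · have h1 := hfb i
    rw [hu, (hum i).natDegree_mul (monic_X_pow _), natDegree_X_pow, expU] at h1
    omega
  · rw [hfun]
    exact hli
  · rw [hfun]
    exact span_eq_of_linearIndependent hdim hfU hli

theorem coeff_isUBasis (hr : 1 ≤ r) (h : Consistent m l k) {U : Submodule ℂ ℂ[X]}
    (hU : IsSpaceU m l k U) {u : Fin (r + 1) → ℂ[X]} (hu : IsUBasis m l k U u)
    (i : Fin (r + 1)) {n : ℕ} (hn : n < gap k l (r - (i : ℕ))) :
    (u i).coeff n * ∏ j : Fin (r + 1), ((ordU m i : ℂ) + n - expU m l k j) =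
      (u i).coeff (n + 1) * ∏ j : Fin (r + 1), ((ordU m i : ℂ) + n + 1 - ordU m j) := by
  obtain ⟨hdim, -, h1, -, -⟩ := (isSpaceU_iff hr).1 hU
  -- The top exponent at `1` supplies the highly vanishing element required by `block_recursion`.
  have hmem : r + k ∈ exponentsAt U 1 := h1 ▸ ⟨Fin.last r, by simp⟩
  obtain ⟨g, hgU, hg0, hg1⟩ := hmem
  obtain ⟨hdeg, hli, hspan⟩ := hu
  have hsupp : ∀ i : Fin (r + 1), (u i * X ^ ordU m (i : ℕ)).support ⊆
      Finset.Icc (ordU m i) (expU m l k i) := fun i n hn => by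
    rw [mem_support_iff, coeff_mul_X_pow'] at hn
    have h1 : ordU m i ≤ n := by
      by_contra hlt
      exact hn (if_neg hlt)
    rw [if_pos h1] at hn
    have h2 := le_natDegree_of_ne_zero hn
    rw [(hdeg i).2] at h2
    rw [Finset.mem_Icc, expU]
    omega
  have key := block_recursion (a := fun i : Fin (r + 1) => ordU m i)
    (b := fun i : Fin (r + 1) => expU m l k i)
    (fun i => ordU_le_expU m l k i) (fun i j hij => expU_lt_ordU h hij (by omega)) (sum_expU h.1)
    hsupp (hspan.symm ▸ hgU) hg0 (hg1 ▸ pow_rootMultiplicity_dvd g 1) i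
    (n := n + ordU m i) (by omega) (by simp only [expU]; omega)
  rw [coeff_mul_X_pow, show n + ordU m (i : ℕ) + 1 = n + 1 + ordU m (i : ℕ) by ring,
    coeff_mul_X_pow] at key
  push_cast at key
  simpa only [add_comm, add_left_comm] using key

end Parameters

/-! ### The Weyl group action on the explicit formula -/

section Explicit

variable {R : Type*} [CommRing R] {r : ℕ}

/-- `l_i - l_{i+1}` over a ring, with `l_0 = k`. -/
def ringGap (k : R) (l : Fin r → R) (i : ℕ) : R := extL k l i - extL k l (i + 1)

/-- `λ_v - λ_q - d_v + j`. -/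
def numTerm (m : Fin r → R) (k : R) (l : Fin r → R) (v q : Fin (r + 1)) (j : ℕ) : R :=
  lowSum m v - lowSum m q - ringGap k l v + j

/-- `λ_v - λ_q - d_v + j + 1 + d_q`. -/
def denTerm (m : Fin r → R) (k : R) (l : Fin r → R) (v q : Fin (r + 1)) (j : ℕ) : R :=
  lowSum m v - lowSum m q - ringGap k l v + j + 1 + ringGap k l q

theorem entry_succ {R : Type*} [Zero R] (a : Fin r → R) {t : ℕ} (ht : t < r) :
    entry a (t + 1) = a ⟨t, ht⟩ := by
  rw [entry, dif_pos ⟨by omega, by omega⟩]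
  rfl

/-- Each entry of `w·m` plus one is a difference of consecutive values of `λ ∘ w`, so the sum
telescopes. -/
theorem sum_entry_weylM (w : Equiv.Perm (Fin (r + 1))) (m : Fin r → R) {s : ℕ} (hs : s ≤ r) :
    ∑ t ∈ Finset.Icc (r - s + 1) r, entry (weylM w m) t + s =
      lowSum m (w (Fin.last r)) - lowSum m (w ⟨r - s, by omega⟩) := by
  induction s with
  | zero =>
    have : (⟨r - 0, by omega⟩ : Fin (r + 1)) = Fin.last r := rfl
    rw [this]
    simp
  | succ s ih =>
    have h1 : Finset.Icc (r - s + 1) r = (Finset.Icc (r - s) r).erase (r - s) := by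
      rw [Finset.Icc_erase_left]
      ext
      simp
    rw [h1] at ih
    have h2 : entry (weylM w m) (r - s) =
        lowSum m (w ⟨r - s, by omega⟩) - lowSum m (w ⟨r - (s + 1), by omega⟩) - 1 := by
      have := entry_succ (weylM w m) (t := r - (s + 1)) (by omega)
      rw [show r - (s + 1) + 1 = r - s by omega] at this
      rw [this, weylM]
      congr 5
      exact Fin.ext (show r - (s + 1) + 1 = r - s by omega)
    rw [show r - (s + 1) + 1 = r - s by omega, ← Finset.sum_erase_add _ _
      (Finset.left_mem_Icc.2 (by omega : r - s ≤ r)), h2]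
    push_cast
    linear_combination ih (by omega)

theorem sum_ringGap (k : R) (l : Fin r → R) : ∑ q : Fin (r + 1), ringGap k l q = k := by
  rw [Fin.sum_univ_eq_sum_range (ringGap k l)]
  simp only [ringGap]
  rw [Finset.sum_range_sub', extL_succ_last]
  simp [extL]

theorem extL_weylL (w : Equiv.Perm (Fin (r + 1))) (k : R) (l : Fin r → R) {q : ℕ}
    (hq : q ≤ r + 1) :
    extL k (weylL w k l) q =
      ∑ p : Fin (r + 1), if q ≤ (p : ℕ) then ringGap k l (w p) else 0 := by
  rcases Nat.eq_zero_or_pos q with rfl | hpos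
  · simp only [Nat.zero_le, if_true]
    rw [Equiv.sum_comp w fun p => ringGap k l p, sum_ringGap]
    simp [extL]
  · obtain ⟨q, rfl⟩ := Nat.exists_eq_succ_of_ne_zero hpos.ne'
    rw [Nat.succ_eq_add_one] at *
    rcases Nat.lt_or_ge q r with h | h
    · rw [extL, if_neg (by omega), entry_succ _ h, weylL, ← Finset.sum_filter]
      refine Finset.sum_congr ?_ fun _ _ => rfl
      ext p
      simp [Fin.le_def]
    · obtain rfl : q = r := by omega
      rw [extL_succ_last]
      symm
      refine Finset.sum_eq_zero fun p _ => if_neg ?_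
      omega

theorem ringGap_weylL (w : Equiv.Perm (Fin (r + 1))) (k : R) (l : Fin r → R) (q : Fin (r + 1)) :
    ringGap k (weylL w k l) q = ringGap k l (w q) := by
  rw [ringGap, extL_weylL w k l (by omega), extL_weylL w k l (by omega), ← Finset.sum_sub_distrib,
    Finset.sum_eq_single q]
  · simp
  · intro p _ hp
    have : (p : ℕ) ≠ q := fun h => hp (Fin.ext h)
    split_ifs <;> first | omega | simp
  · simp

theorem entry_weylL_last (hr : 1 ≤ r) (w : Equiv.Perm (Fin (r + 1))) (k : R) (l : Fin r → R) :
    entry (weylL w k l) r = ringGap k l (w (Fin.last r)) := by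
  rw [← ringGap_weylL, ringGap, Fin.val_last, extL_succ_last, sub_zero, extL, if_neg (by omega)]

theorem numFactor_weyl (hr : 1 ≤ r) (w : Equiv.Perm (Fin (r + 1))) (m l : Fin r → ℂ) (k : ℂ)
    (j : ℕ) {s : ℕ} (hs : s ≤ r) :
    numFactor (weylM w m) (weylL w k l) j s =
      numTerm m k l (w (Fin.last r)) (w ⟨r - s, by omega⟩) j := by
  rw [numFactor, numTerm, entry_weylL_last hr, ← sum_entry_weylM w m hs]
  ring

theorem denFactor_weyl (hr : 1 ≤ r) (w : Equiv.Perm (Fin (r + 1))) (m l : Fin r → ℂ) (k : ℂ)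
    (j : ℕ) {s : ℕ} (hs : s ≤ r) :
    denFactor (weylM w m) (weylL w k l) k j s =
      denTerm m k l (w (Fin.last r)) (w ⟨r - s, by omega⟩) j := by
  have h := ringGap_weylL w k l ⟨r - s, by omega⟩
  rw [ringGap] at h
  rw [denFactor, denTerm, entry_weylL_last hr, ← sum_entry_weylM w m hs, ← h]
  ring

/-- As `s` runs over `1, …, r`, the index `w(r - s)` runs over everything except `w(r)`. This is why
the formula depends on `w` only through `w(r)`. -/
theorem prod_Icc_weyl (w : Equiv.Perm (Fin (r + 1))) (F : ℕ → ℂ) (G : Fin (r + 1) → ℂ)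
    (h : ∀ s, (hs : s ≤ r) → F s = G (w ⟨r - s, by omega⟩)) :
    ∏ s ∈ Finset.Icc 1 r, F s = ∏ q ∈ Finset.univ.erase (w (Fin.last r)), G q := by
  refine Finset.prod_bij' (fun s _ => w ⟨r - s, by omega⟩) (fun q _ => r - (w.symm q : ℕ))
    ?_ ?_ ?_ ?_ ?_
  · intro s hs
    rw [Finset.mem_Icc] at hs
    rw [Finset.mem_erase, Ne, w.injective.eq_iff, Fin.ext_iff, Fin.val_last]
    exact ⟨by simp only; omega, Finset.mem_univ _⟩
  · intro q hq
    have : w.symm q ≠ Fin.last r := fun hl => (Finset.mem_erase.1 hq).1 (by rw [← hl]; simp)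
    have h2 : (w.symm q : ℕ) < r := Fin.val_lt_last this
    rw [Finset.mem_Icc]
    omega
  · intro s hs
    rw [Finset.mem_Icc] at hs
    simp only [Equiv.symm_apply_apply]
    omega
  · intro q _
    have : (⟨r - (r - (w.symm q : ℕ)), by omega⟩ : Fin (r + 1)) = w.symm q :=
      Fin.ext (show r - (r - (w.symm q : ℕ)) = w.symm q by omega)
    rw [this, Equiv.apply_symm_apply]
  · intro s hs
    exact h s (Finset.mem_Icc.1 hs).2

theorem coeffC_weyl (hr : 1 ≤ r) (n : ℕ) (w : Equiv.Perm (Fin (r + 1))) (m l : Fin r → ℂ) (k : ℂ)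
    (i : ℕ) :
    coeffC n (weylM w m) (weylL w k l) k i = (n.choose i : ℂ) * ∏ j ∈ Finset.range i,
      ∏ q ∈ Finset.univ.erase (w (Fin.last r)),
        numTerm m k l (w (Fin.last r)) q j / denTerm m k l (w (Fin.last r)) q j := by
  rw [coeffC]
  congr 1
  refine Finset.prod_congr rfl fun j _ => prod_Icc_weyl w _ _ fun s hs => ?_
  rw [numFactor_weyl hr _ _ _ _ _ hs, denFactor_weyl hr _ _ _ _ _ hs]

theorem denNonzero_weyl (hr : 1 ≤ r) (n : ℕ) (w : Equiv.Perm (Fin (r + 1))) (m l : Fin r → ℂ)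
    (k : ℂ) :
    DenNonzero n (weylM w m) (weylL w k l) k ↔ ∀ j < n,
      ∏ q ∈ Finset.univ.erase (w (Fin.last r)), denTerm m k l (w (Fin.last r)) q j ≠ 0 := by
  refine forall₂_congr fun j _ => ?_
  rw [← prod_Icc_weyl w (fun s => denFactor (weylM w m) (weylL w k l) k j s)
    (fun q => denTerm m k l (w (Fin.last r)) q j)
    fun s hs => denFactor_weyl hr w m l k j hs, Finset.prod_ne_zero_iff]
  simp [Finset.mem_Icc]

theorem weylM_one (m : Fin r → R) : weylM 1 m = m := by
  funext p
  simp only [weylM, lowSum, Equiv.Perm.one_apply, Fin.val_succ, Fin.val_castSucc]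
  rw [Finset.sum_Icc_succ_top (by omega), entry_succ _ p.2]
  push_cast
  ring

theorem weylL_one (k : R) (l : Fin r → R) : weylL 1 k l = l := by
  -- Induction downwards from `q = r + 1`, where both extended sequences are zero; the gaps agree
  -- throughout.
  have h : ∀ d q : ℕ, q + d = r + 1 → extL k (weylL 1 k l) q = extL k l q := by
    intro d
    induction d with
    | zero =>
      intro q hq
      obtain rfl : q = r + 1 := hq
      rw [extL_succ_last, extL_succ_last]
    | succ d ih =>
      intro q hq
      have h1 := ringGap_weylL 1 k l ⟨q, by omega⟩
      simp only [Equiv.Perm.one_apply, ringGap, ih (q + 1) (by omega)] at h1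
      exact sub_left_injective h1
  funext p
  have := h (r - p) (p + 1) (by omega)
  rwa [extL, if_neg (by omega), extL, if_neg (by omega), entry_succ _ p.2, entry_succ _ p.2] at this

theorem coeff_explicitU (n : ℕ) (m l : Fin r → ℂ) (k : ℂ) {t : ℕ} (ht : t ≤ n) :
    (explicitU n m l k).coeff (n - t) = (-1) ^ t * coeffC n m l k t := by
  rw [explicitU, finsetSum_coeff, Finset.sum_eq_single t]
  · rw [coeff_C_mul_X_pow, if_pos rfl]
  · intro s hs hst
    rw [Finset.mem_range] at hs
    rw [coeff_C_mul_X_pow, if_neg (by omega)]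
  · intro h
    exact absurd (Finset.mem_range.2 (by omega)) h

theorem natDegree_explicitU_le (n : ℕ) (m l : Fin r → ℂ) (k : ℂ) :
    (explicitU n m l k).natDegree ≤ n :=
  natDegree_sum_le_of_forall_le _ _ fun t _ => (natDegree_C_mul_X_pow_le _ _).trans (Nat.sub_le n t)

end Explicit

/-! ### The explicit formula for consistent parameters -/

section Consistent

variable {r : ℕ} {m l : Fin r → ℕ} {k : ℕ}

theorem entry_toC (a : Fin r → ℕ) (t : ℕ) : entry (toC a) t = ((entry a t : ℕ) : ℂ) := by
  unfold entry
  split_ifs <;> simp [toC]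

theorem extL_toC (k : ℕ) (l : Fin r → ℕ) (i : ℕ) :
    extL (k : ℂ) (toC l) i = ((extL k l i : ℕ) : ℂ) := by
  unfold extL
  split_ifs
  · rfl
  · exact entry_toC l i

theorem lowSum_toC (m : Fin r → ℕ) (i : ℕ) : lowSum (toC m) i = ((natLowSum m i : ℕ) : ℂ) := by
  rw [lowSum, natLowSum]
  push_cast
  simp only [entry_toC]
  rw [add_comm]

theorem ringGap_toC (h : IsPartitionBelow l k) {i : ℕ} (hi : i ≤ r) :
    ringGap (k : ℂ) (toC l) i = ((gap k l i : ℕ) : ℂ) := by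
  rw [ringGap, extL_toC, extL_toC, ← gap_add_extL h hi]
  push_cast
  ring

/-- The dictionary between `λ` and `U`: block `i` corresponds to the index `r - i`, since `ordU m i
+ λ_{r-i}` does not depend on `i`. -/
theorem denTerm_toC (h : IsPartitionBelow l k) (i q : Fin (r + 1)) (j : ℕ) :
    denTerm (toC m) k (toC l) (Fin.rev i) q j =
      (expU m l k (Fin.rev q) : ℂ) - expU m l k i + j + 1 := by
  have h1 := ordU_add_natLowSum m (i := i) (by omega)
  have h2 := ordU_add_natLowSum m (i := Fin.rev q) (by omega)
  have hi : ((Fin.rev i : Fin (r + 1)) : ℕ) = r - i := by rw [Fin.val_rev]; omega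
  have hq : r - ((Fin.rev q : Fin (r + 1)) : ℕ) = q := by rw [Fin.val_rev]; omega
  rw [hq] at h2
  rw [denTerm, lowSum_toC, lowSum_toC, ringGap_toC h (by omega), ringGap_toC h (by omega), expU,
    expU, hi, hq]
  have h3 : (ordU m i : ℂ) + natLowSum m (r - i) = ordU m (Fin.rev q) + natLowSum m q := by
    exact_mod_cast h1.trans h2.symm
  push_cast
  linear_combination h3

theorem numTerm_toC (h : IsPartitionBelow l k) (i q : Fin (r + 1)) (j : ℕ) :
    numTerm (toC m) k (toC l) (Fin.rev i) q j =
      (ordU m (Fin.rev q) : ℂ) - expU m l k i + j := by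
  have h1 := denTerm_toC (m := m) h i q j
  have hq : r - ((Fin.rev q : Fin (r + 1)) : ℕ) = q := by rw [Fin.val_rev]; omega
  have h2 : denTerm (toC m) k (toC l) (Fin.rev i) q j =
    numTerm (toC m) k (toC l) (Fin.rev i) q j + 1 + ringGap (k : ℂ) (toC l) q := rfl
  rw [h2, ringGap_toC h (by omega)] at h1
  have h3 : (expU m l k (Fin.rev q) : ℂ) = ordU m (Fin.rev q) + gap k l q := by
    rw [expU, hq]
    push_cast
    rfl
  rw [h3] at h1
  linear_combination h1

/-- A zero would place the right end of another block at `expU i - j - 1`, which lies inside block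
`i` because `j` is less than its length. -/
theorem denTerm_ne_zero (h : Consistent m l k) (i q : Fin (r + 1)) (hq : q ≠ Fin.rev i) {j : ℕ}
    (hj : j < gap k l (r - (i : ℕ))) :
    denTerm (toC m) k (toC l) (Fin.rev i) q j ≠ 0 := by
  rw [denTerm_toC h.1]
  intro h0
  have h1 : expU m l k (Fin.rev q) + j + 1 = expU m l k i := by
    have : (expU m l k (Fin.rev q) : ℂ) + j + 1 = expU m l k i := by linear_combination h0
    exact_mod_cast this
  have hqi : Fin.rev q ≠ i := fun h => hq (by rw [← h, Fin.rev_rev])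
  have hE : expU m l k i = ordU m i + gap k l (r - (i : ℕ)) := rfl
  rcases lt_or_gt_of_ne hqi with hlt | hlt
  · have := expU_lt_ordU h hlt (by omega)
    omega
  · have := expU_strictMono h hlt
    simp only at this
    omega

theorem prod_erase_rev (i : Fin (r + 1)) (F : Fin (r + 1) → ℂ) :
    ∏ j, F j = F i * ∏ q ∈ Finset.univ.erase (Fin.rev i), F (Fin.rev q) := by
  rw [← Equiv.prod_comp Fin.revPerm F, ← Finset.mul_prod_erase _ _ (Finset.mem_univ (Fin.rev i))]
  simp

theorem prod_erase_neg (v : Fin (r + 1)) (F G : Fin (r + 1) → ℂ) (h : ∀ q, F q = -G q) :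
    ∏ q ∈ Finset.univ.erase v, F q = (-1) ^ r * ∏ q ∈ Finset.univ.erase v, G q := by
  have hc : (Finset.univ.erase v).card = r := by
    rw [Finset.card_erase_of_mem (Finset.mem_univ v), Finset.card_univ, Fintype.card_fin,
      Nat.add_sub_cancel]
  have h' : ∀ q, F q = -1 * G q := fun q => by rw [h]; ring
  simp_rw [h']
  rw [Finset.prod_mul_distrib, Finset.prod_const, hc]

/-- The recursion is solved from the leading coefficient `1` downwards. The factors of block `i`
itself are `-(t + 1)` and `n - t` and build the binomial coefficient; the other blocks give
`denTerm` and `numTerm`, with the sign `(-1)^r` on both sides. -/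
theorem isUBasis_explicit (hr : 1 ≤ r) (h : Consistent m l k) {U : Submodule ℂ ℂ[X]}
    (hU : IsSpaceU m l k U) {u : Fin (r + 1) → ℂ[X]} (hu : IsUBasis m l k U u)
    (i : Fin (r + 1)) (w : Equiv.Perm (Fin (r + 1))) (hw : w (Fin.last r) = Fin.rev i) :
    DenNonzero (gap k l (r - (i : ℕ))) (weylM w (toC m)) (weylL w (k : ℂ) (toC l)) k ∧
      u i = explicitU (gap k l (r - (i : ℕ)))
        (weylM w (toC m)) (weylL w (k : ℂ) (toC l)) k := by
  have hden : ∀ j < gap k l (r - (i : ℕ)), ∏ q ∈ Finset.univ.erase (Fin.rev i),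
      denTerm (toC m) (k : ℂ) (toC l) (Fin.rev i) q j ≠ 0 := fun j hj =>
    Finset.prod_ne_zero_iff.2 fun q hq => denTerm_ne_zero h i q (Finset.ne_of_mem_erase hq) hj
  refine ⟨(denNonzero_weyl hr _ w _ _ _).2 (hw ▸ hden), ?_⟩
  obtain ⟨hmonic, hdeg⟩ := hu.1 i
  set n := gap k l (r - (i : ℕ)) with hn
  have hcoeff : ∀ t ≤ n, (u i).coeff (n - t) = (-1) ^ t *
      coeffC n (weylM w (toC m)) (weylL w (k : ℂ) (toC l)) k t := by
    intro t
    induction t with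
    | zero =>
      intro _
      rw [Nat.sub_zero, ← hdeg, hmonic.coeff_natDegree]
      simp [coeffC]
    | succ t ih =>
      intro ht
      have hrec := coeff_isUBasis hr h hU hu i (n := n - (t + 1)) (by omega)
      rw [show n - (t + 1) + 1 = n - t by omega, ih (by omega), prod_erase_rev i, prod_erase_rev i,
        prod_erase_neg (Fin.rev i) (fun q => (ordU m i : ℂ) + ((n - (t + 1) : ℕ) : ℂ) -
            expU m l k (Fin.rev q))
          (fun q => denTerm (toC m) (k : ℂ) (toC l) (Fin.rev i) q t),
        prod_erase_neg (Fin.rev i) (fun q => (ordU m i : ℂ) + ((n - (t + 1) : ℕ) : ℂ) + 1 -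
            ordU m (Fin.rev q))
          (fun q => numTerm (toC m) (k : ℂ) (toC l) (Fin.rev i) q t)] at hrec
      · rw [coeffC_weyl hr, hw] at hrec ⊢
        rw [Finset.prod_range_succ, Finset.prod_div_distrib]
        have hd := hden t (by omega)
        have hch : ((n.choose (t + 1) : ℕ) : ℂ) * (t + 1) = n.choose t * (n - t) := by
          have := Nat.choose_succ_right_eq n t
          rw [← Nat.cast_sub (by omega)]
          exact_mod_cast this
        have hE : (expU m l k i : ℂ) = ordU m i + n := by
          rw [expU]
          push_cast
          rfl
        rw [hE, Nat.cast_sub ht] at hrec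
        have ht0 : (t : ℂ) + 1 ≠ 0 := by exact_mod_cast Nat.succ_ne_zero t
        have hs : ((-1 : ℂ)) ^ r ≠ 0 := pow_ne_zero _ (by norm_num)
        set D := ∏ q ∈ Finset.univ.erase (Fin.rev i),
          denTerm (toC m) (k : ℂ) (toC l) (Fin.rev i) q t
        set N := ∏ q ∈ Finset.univ.erase (Fin.rev i),
          numTerm (toC m) (k : ℂ) (toC l) (Fin.rev i) q t
        set P := ∏ j ∈ Finset.range t, ∏ q ∈ Finset.univ.erase (Fin.rev i),
          numTerm (toC m) (k : ℂ) (toC l) (Fin.rev i) q j /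
            denTerm (toC m) (k : ℂ) (toC l) (Fin.rev i) q j
        refine mul_right_cancel₀ (mul_ne_zero (mul_ne_zero ht0 hs) hd) ?_
        have hDN : N / D * D = N := div_mul_cancel₀ _ hd
        push_cast at hrec
        rw [pow_succ]
        linear_combination (-1) * hrec + ((-1) ^ t * P * N * (-1) ^ r) * hch
          + ((-1) ^ t * (n.choose (t + 1) : ℂ) * P * (t + 1) * (-1) ^ r) * hDN
      · intro q
        rw [numTerm_toC h.1, show expU m l k i = ordU m i + n from rfl, Nat.cast_sub ht]
        push_cast
        ring
      · intro q
        rw [denTerm_toC h.1, show expU m l k i = ordU m i + n from rfl, Nat.cast_sub ht]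
        push_cast
        ring
  ext N
  rcases Nat.lt_or_ge n N with hlt | hle
  · rw [coeff_eq_zero_of_natDegree_lt (by omega), coeff_eq_zero_of_natDegree_lt
      ((natDegree_explicitU_le _ _ _ _).trans_lt hlt)]
  · have h1 := hcoeff (n - N) (by omega)
    rw [← coeff_explicitU _ _ _ _ (by omega), show n - (n - N) = N by omega] at h1
    exact h1

end Consistent

/-! ### Exponents of the dual space of divided Wronskians -/

section Dual

variable {r : ℕ}

theorem range_comp_rev {β : Type*} (F : Fin (r + 1) → β) :
    Set.range (fun j => F (Fin.rev j)) = Set.range F :=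
  Fin.rev_surjective.range_comp F

theorem sum_succAbove_add {α : Fin (r + 1) → ℕ} (j : Fin (r + 1)) :
    ∑ i, α (j.succAbove i) + α j = ∑ i, α i := by
  rw [Fin.sum_univ_succAbove α j, add_comm]

/-- In a basis adapted to `z`, omitting `g j` lowers the sum of the exponents by `α j`. The
resulting orders are distinct, hence they are all the exponents. -/
theorem dualSpan_exponents {f : Fin (r + 1) → ℂ[X]} (hf : LinearIndependent ℂ f) {z : ℂ}
    {α δ : Fin (r + 1) → ℕ} (hα : Function.Injective α)
    (hexp : exponentsAt (Submodule.span ℂ (Set.range f)) z = Set.range α)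
    (hδ : ∀ j, δ (Fin.rev j) + ∑ i : Fin r, (i : ℕ) + α j = ∑ i, α i) :
    exponentsAt (dualSpan f) z = Set.range δ ∧ Module.finrank ℂ (dualSpan f) = r + 1 := by
  obtain ⟨g, hg, hspan⟩ := exists_basis_of_exponentsAt
    (by rw [finrank_span_eq_card hf, Fintype.card_fin]) hα hexp
  have hgi := linearIndependent_of_rootMultiplicity z hα (fun i => (hg i).1) fun i => (hg i).2
  rw [dualSpan_eq hf hgi hspan.symm]
  have hw := fun j : Fin (r + 1) => wronskianDet_order z (f := fun i => g (j.succAbove i))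
    (α := fun i => α (j.succAbove i)) (hα.comp Fin.succAbove_right_injective)
    (fun i => (hg _).1) fun i => (hg _).2
  have hord : ∀ j, (wronskianDet fun b => g (j.succAbove b)).rootMultiplicity z =
      δ (Fin.rev j) := fun j => by
    have h1 := (hw j).2
    have h2 := hδ j
    have h3 := sum_succAbove_add (α := α) j
    omega
  have hinj : Function.Injective fun j => δ (Fin.rev j) := fun i j hij => by
    have h1 := hδ i
    have h2 := hδ j
    simp only at hij
    exact hα (by omega)
  constructor
  · rw [← range_comp_rev δ]
    exact exponentsAt_span z hinj (fun j => (hw j).1) hord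
  · rw [dualSpan, finrank_span_eq_card (linearIndependent_of_rootMultiplicity z hinj
      (fun j => (hw j).1) hord), Fintype.card_fin]

theorem dualSpan_exponentsAtInfty {f : Fin (r + 1) → ℂ[X]} (hf : LinearIndependent ℂ f)
    {β δ : Fin (r + 1) → ℕ} (hβ : Function.Injective β)
    (hexp : exponentsAtInfty (Submodule.span ℂ (Set.range f)) = Set.range β)
    (hδ : ∀ j, δ (Fin.rev j) + ∑ i : Fin r, (i : ℕ) + β j = ∑ i, β i) :
    exponentsAtInfty (dualSpan f) = Set.range δ := by
  obtain ⟨g, hg, hspan⟩ := exists_basis_of_exponentsAtInfty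
    (by rw [finrank_span_eq_card hf, Fintype.card_fin]) hβ hexp
  have hgi := linearIndependent_of_natDegree hβ (fun i => (hg i).1) fun i => (hg i).2
  rw [dualSpan_eq hf hgi hspan.symm]
  have hw := fun j : Fin (r + 1) => wronskianDet_degree (f := fun i => g (j.succAbove i))
    (β := fun i => β (j.succAbove i)) (hβ.comp Fin.succAbove_right_injective)
    (fun i => (hg _).1) fun i => (hg _).2
  have hdeg : ∀ j, (wronskianDet fun b => g (j.succAbove b)).natDegree =
      δ (Fin.rev j) := fun j => by
    have h1 := (hw j).2
    have h2 := hδ j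
    have h3 := sum_succAbove_add (α := β) j
    omega
  have hinj : Function.Injective fun j => δ (Fin.rev j) := fun i j hij => by
    have h1 := hδ i
    have h2 := hδ j
    simp only at hij
    exact hβ (by omega)
  rw [← range_comp_rev δ]
  exact exponentsAtInfty_span hinj (fun j => (hw j).1) hdeg

/-- The polynomials `h` with `T * h ∈ D`. -/
def divided (T : ℂ[X]) (D : Submodule ℂ ℂ[X]) : Submodule ℂ ℂ[X] :=
  D.comap (LinearMap.mulLeft ℂ T)

theorem mem_divided {T h : ℂ[X]} {D : Submodule ℂ ℂ[X]} : h ∈ divided T D ↔ T * h ∈ D := Iff.rfl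

section Divided

variable {T : ℂ[X]} {D : Submodule ℂ ℂ[X]}

theorem finrank_divided (hT : T ≠ 0) (hD : ∀ x ∈ D, T ∣ x) :
    Module.finrank ℂ (divided T D) = Module.finrank ℂ D := by
  have hinj : Function.Injective (LinearMap.mulLeft ℂ T) := fun x y h => mul_left_cancel₀ hT h
  rw [(Submodule.equivMapOfInjective _ hinj (divided T D)).finrank_eq, divided,
    Submodule.map_comap_eq_self]
  intro x hx
  obtain ⟨q, rfl⟩ := hD x hx
  exact ⟨q, rfl⟩

theorem exponentsAt_divided (hT : T ≠ 0) (hD : ∀ x ∈ D, T ∣ x) {z : ℂ} {δ : Fin (r + 1) → ℕ}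
    (h : exponentsAt D z = Set.range fun j => δ j + T.rootMultiplicity z) :
    exponentsAt (divided T D) z = Set.range δ := by
  ext a
  have hmem : a ∈ exponentsAt (divided T D) z ↔ a + T.rootMultiplicity z ∈ exponentsAt D z := by
    constructor
    · rintro ⟨f, hf, hf0, rfl⟩
      refine ⟨T * f, hf, mul_ne_zero hT hf0, ?_⟩
      rw [rootMultiplicity_mul (mul_ne_zero hT hf0), add_comm]
    · rintro ⟨f, hf, hf0, hfa⟩
      obtain ⟨q, rfl⟩ := hD f hf
      rw [rootMultiplicity_mul hf0] at hfa
      exact ⟨q, hf, right_ne_zero_of_mul hf0, by omega⟩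
  rw [hmem, h]
  simp

theorem exponentsAtInfty_divided (hT : T ≠ 0) (hD : ∀ x ∈ D, T ∣ x) {δ : Fin (r + 1) → ℕ}
    (h : exponentsAtInfty D = Set.range fun j => δ j + T.natDegree) :
    exponentsAtInfty (divided T D) = Set.range δ := by
  ext a
  have hmem : a ∈ exponentsAtInfty (divided T D) ↔ a + T.natDegree ∈ exponentsAtInfty D := by
    constructor
    · rintro ⟨f, hf, hf0, rfl⟩
      refine ⟨T * f, hf, mul_ne_zero hT hf0, ?_⟩
      rw [natDegree_mul hT hf0, add_comm]
    · rintro ⟨f, hf, hf0, hfa⟩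
      obtain ⟨q, rfl⟩ := hD f hf
      have hq := right_ne_zero_of_mul hf0
      rw [natDegree_mul hT hq] at hfa
      exact ⟨q, hf, hq, by omega⟩
  rw [hmem, h]
  simp

end Divided

theorem X_pow_mul_facts (A B : ℕ) :
    (X ^ A * (X - C 1) ^ B : ℂ[X]).Monic ∧
    (X ^ A * (X - C 1) ^ B : ℂ[X]).rootMultiplicity 0 = A ∧
    (X ^ A * (X - C 1) ^ B : ℂ[X]).rootMultiplicity 1 = B ∧
    (∀ z : ℂ, z ≠ 0 → z ≠ 1 → (X ^ A * (X - C 1) ^ B : ℂ[X]).rootMultiplicity z = 0) ∧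
    (X ^ A * (X - C 1) ^ B : ℂ[X]).natDegree = A + B := by
  have hm : (X ^ A * (X - C 1) ^ B : ℂ[X]).Monic :=
    (monic_X_pow A).mul ((monic_X_sub_C 1).pow B)
  have h0 : (X ^ A : ℂ[X]).rootMultiplicity 0 = A := by
    simpa using rootMultiplicity_X_sub_C_pow (0 : ℂ) A
  refine ⟨hm, ?_, ?_, fun z hz0 hz1 => ?_, ?_⟩
  · rw [rootMultiplicity_mul hm.ne_zero, h0, rootMultiplicity_eq_zero (p := (X - C 1) ^ B),
      add_zero]
    simp [IsRoot]
  · rw [rootMultiplicity_mul hm.ne_zero, rootMultiplicity_X_sub_C_pow,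
      rootMultiplicity_eq_zero (p := X ^ A), zero_add]
    simp [IsRoot]
  · refine rootMultiplicity_eq_zero ?_
    simp [IsRoot, hz0, sub_eq_zero, hz1]
  · rw [(monic_X_pow A).natDegree_mul ((monic_X_sub_C 1).pow B), natDegree_X_pow, natDegree_pow,
      natDegree_X_sub_C, mul_one]

/-- The exponents of the space of divided Wronskians. -/
theorem divided_dualSpan {W : Submodule ℂ ℂ[X]} {f : Fin (r + 1) → ℂ[X]}
    (hf : LinearIndependent ℂ f) (hspan : Submodule.span ℂ (Set.range f) = W) (A B : ℕ)
    {α₀ α₁ β δ₀ δ₁ ε : Fin (r + 1) → ℕ} (hα₀ : Function.Injective α₀)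
    (hα₁ : Function.Injective α₁) (hβ : Function.Injective β)
    (h0 : exponentsAt W 0 = Set.range α₀) (h1 : exponentsAt W 1 = Set.range α₁)
    (hz : ∀ z : ℂ, z ≠ 0 → z ≠ 1 → exponentsAt W z = Set.range fun j : Fin (r + 1) => (j : ℕ))
    (hinf : exponentsAtInfty W = Set.range β)
    (hδ₀ : ∀ j, δ₀ (Fin.rev j) + A + ∑ i : Fin r, (i : ℕ) + α₀ j = ∑ i, α₀ i)
    (hδ₁ : ∀ j, δ₁ (Fin.rev j) + B + ∑ i : Fin r, (i : ℕ) + α₁ j = ∑ i, α₁ i)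
    (hε : ∀ j, ε (Fin.rev j) + (A + B) + ∑ i : Fin r, (i : ℕ) + β j = ∑ i, β i) :
    (∀ x ∈ dualSpan f, X ^ A * (X - C 1) ^ B ∣ x) ∧
    Module.finrank ℂ (divided (X ^ A * (X - C 1) ^ B) (dualSpan f)) = r + 1 ∧
    exponentsAt (divided (X ^ A * (X - C 1) ^ B) (dualSpan f)) 0 = Set.range δ₀ ∧
    exponentsAt (divided (X ^ A * (X - C 1) ^ B) (dualSpan f)) 1 = Set.range δ₁ ∧
    (∀ z : ℂ, z ≠ 0 → z ≠ 1 → exponentsAt (divided (X ^ A * (X - C 1) ^ B) (dualSpan f)) z =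
      Set.range fun j : Fin (r + 1) => (j : ℕ)) ∧
    exponentsAtInfty (divided (X ^ A * (X - C 1) ^ B) (dualSpan f)) = Set.range ε := by
  subst hspan
  obtain ⟨hm, hm0, hm1, hmz, hmd⟩ := X_pow_mul_facts A B
  set T : ℂ[X] := X ^ A * (X - C 1) ^ B with hT
  obtain ⟨hd0, hdim⟩ := dualSpan_exponents (δ := fun j => δ₀ j + A) hf hα₀ h0 hδ₀
  obtain ⟨hd1, -⟩ := dualSpan_exponents (δ := fun j => δ₁ j + B) hf hα₁ h1 hδ₁
  -- The generic sequence `0, …, r` is its own dual: omitting `j` leaves a Wronskian of order `r -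
  -- j`.
  have hdz := fun (z : ℂ) (hz0 : z ≠ 0) (hz1 : z ≠ 1) =>
    (dualSpan_exponents (δ := fun j : Fin (r + 1) => (j : ℕ)) hf
      (α := fun j : Fin (r + 1) => (j : ℕ)) Fin.val_injective (hz z hz0 hz1) (by
        intro j
        rw [Fin.sum_univ_castSucc, Fin.val_rev]
        simp only [Fin.val_castSucc, Fin.val_last]
        omega)).1
  have hdinf := dualSpan_exponentsAtInfty (δ := fun j => ε j + (A + B)) hf hβ hinf hε
  have hdvd : ∀ x ∈ dualSpan f, T ∣ x := by
    intro x hx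
    rcases eq_or_ne x 0 with rfl | hx0
    · exact dvd_zero _
    have hA : X ^ A ∣ x := by
      have : x.rootMultiplicity 0 ∈ Set.range fun j => δ₀ j + A := hd0 ▸ ⟨x, hx, hx0, rfl⟩
      obtain ⟨j, hj⟩ := this
      have := (le_rootMultiplicity_iff hx0 (a := 0) (n := A)).1 (by
        simp only at hj
        omega)
      simpa using this
    have hB : (X - C 1) ^ B ∣ x := by
      have : x.rootMultiplicity 1 ∈ Set.range fun j => δ₁ j + B := hd1 ▸ ⟨x, hx, hx0, rfl⟩
      obtain ⟨j, hj⟩ := this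
      exact (le_rootMultiplicity_iff hx0).1 (by
        simp only at hj
        omega)
    have hco : IsCoprime (X : ℂ[X]) (X - C 1) := by
      simpa using isCoprime_X_sub_C_of_isUnit_sub (R := ℂ) (a := 0) (b := 1) (by simp)
    exact hco.pow.mul_dvd hA hB
  refine ⟨hdvd, by rw [finrank_divided hm.ne_zero hdvd, hdim], ?_, ?_, fun z hz0 hz1 => ?_, ?_⟩
  · exact exponentsAt_divided hm.ne_zero hdvd (by rw [hm0, hd0])
  · exact exponentsAt_divided hm.ne_zero hdvd (by rw [hm1, hd1])
  · exact exponentsAt_divided hm.ne_zero hdvd (by rw [hmz z hz0 hz1, hdz z hz0 hz1]; rfl)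
  · exact exponentsAtInfty_divided hm.ne_zero hdvd (by rw [hmd, hdinf])

end Dual

/-! ### Duality between `U` and `V`, and the polynomial `y_r` -/

section Duality

variable {r : ℕ} {m l : Fin r → ℕ} {k : ℕ}

theorem expV_add_gap (h : IsPartitionBelow l k) {i : ℕ} (hi : i ≤ r) :
    expV m l k i + gap k l i = natLowSum m i + k := by
  have := gap_le h hi
  rw [expV, natLowSum]
  omega

theorem expV_strictMono (h : IsPartitionBelow l k) (hm : Consistent m l k) :
    StrictMono fun i : Fin (r + 1) => expV m l k i := by
  refine Fin.strictMono_iff_lt_succ.2 fun i => ?_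
  have h1 := expV_add_gap (m := m) h (i := i) (by omega)
  have h2 := expV_add_gap (m := m) h (i := i + 1) (by omega)
  have h3 := natLowSum_succ m i
  have h4 := gap_le_entry hm (i := i + 1) (by omega) (by omega)
  simp only [Fin.val_castSucc, Fin.val_succ]
  omega

theorem sum_expV (h : IsPartitionBelow l k) :
    ∑ i : Fin (r + 1), expV m l k i = ∑ i : Fin (r + 1), natLowSum m i + r * k := by
  have h1 : ∑ i : Fin (r + 1), (expV m l k i + gap k l i) =
      ∑ i : Fin (r + 1), (natLowSum m i + k) :=
    Finset.sum_congr rfl fun i _ => expV_add_gap h (by omega)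
  rw [Finset.sum_add_distrib, Finset.sum_add_distrib, Fin.sum_univ_eq_sum_range (gap k l),
    sum_gap h] at h1
  simp only [Finset.sum_const, Finset.card_univ, Fintype.card_fin, smul_eq_mul] at h1
  linarith

theorem sum_ite_last (r k : ℕ) :
    ∑ i : Fin (r + 1), ((i : ℕ) + if (i : ℕ) = r then k else 0) =
      ∑ i : Fin r, (i : ℕ) + r + k := by
  rw [Fin.sum_univ_castSucc]
  have : ∀ i : Fin r, (i : ℕ) ≠ r := fun i => i.2.ne
  simp [this]
  ring

theorem sum_ite_zero (r k : ℕ) :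
    ∑ i : Fin (r + 1), ((i : ℕ) + if (i : ℕ) = 0 then 0 else k) =
      ∑ i : Fin r, (i : ℕ) + r + r * k := by
  rw [Fin.sum_univ_succ]
  simp [Finset.sum_add_distrib]

theorem ordU_rev (m : Fin r → ℕ) (j : Fin (r + 1)) :
    ordU m (Fin.rev j) + natLowSum m j = natLowSum m r := by
  have := ordU_add_natLowSum m (i := Fin.rev j) (by omega)
  rwa [show r - ((Fin.rev j : Fin (r + 1)) : ℕ) = j by rw [Fin.val_rev]; omega] at this

theorem expU_rev (m l : Fin r → ℕ) (k : ℕ) (j : Fin (r + 1)) :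
    expU m l k (Fin.rev j) = ordU m (Fin.rev j) + gap k l j := by
  rw [expU, show r - ((Fin.rev j : Fin (r + 1)) : ℕ) = j by rw [Fin.val_rev]; omega]

theorem exists_isSpaceV (hr : 1 ≤ r) (h : Consistent m l k) :
    ∃ V : Submodule ℂ ℂ[X], IsSpaceV m l k V := by
  obtain ⟨U, hU⟩ := exists_isSpaceU hr h
  obtain ⟨hdim, h0, h1, hz, hinf⟩ := (isSpaceU_iff hr).1 hU
  obtain ⟨f, hf, hspan⟩ := exists_basis_of_exponentsAt hdim (ordU_strictMono m).injective h0
  have hli := linearIndependent_of_rootMultiplicity 0 (ordU_strictMono m).injective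
    (fun i => (hf i).1) fun i => (hf i).2
  -- The excess `A` is the order at `0` of the Wronskian omitting the largest exponent, the smallest
  -- order in the dual space. At `1` that Wronskian does not vanish, so the common factor is `x^A`
  -- alone.
  have hle : ∑ i : Fin r, (i : ℕ) + natLowSum m r ≤ ∑ i : Fin (r + 1), ordU m i := by
    have hlast := ordU_rev m 0
    rw [Fin.sum_univ_castSucc]
    have h2 : ordU m (Fin.last r) = natLowSum m r := by
      simpa [natLowSum] using hlast
    rw [h2]
    refine Nat.add_le_add_right (Finset.sum_le_sum fun i _ => ?_) _
    exact Nat.le_add_left _ _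
  obtain ⟨A, hA⟩ := Nat.exists_eq_add_of_le hle
  have key : ∀ j : Fin (r + 1), natLowSum m (Fin.rev j) + ordU m j = natLowSum m r := fun j => by
    have := ordU_rev m (Fin.rev j)
    rw [Fin.rev_rev] at this
    omega
  refine ⟨_, isSpaceV_iff.2 (divided_dualSpan (f := f) hli hspan A 0
    (ordU_strictMono m).injective ?_ (expU_strictMono h).injective h0 h1 hz hinf
    (δ₀ := fun j : Fin (r + 1) => natLowSum m j)
    (δ₁ := fun j : Fin (r + 1) => (j : ℕ) + if (j : ℕ) = 0 then 0 else k)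
    (ε := fun j : Fin (r + 1) => expV m l k j) ?_ ?_ ?_).2⟩
  · intro i j hij
    simp only at hij
    refine Fin.ext ?_
    split_ifs at hij <;> omega
  · intro j
    have := key j
    omega
  · intro j
    rw [sum_ite_last]
    simp only [Fin.val_rev]
    split_ifs <;> omega
  · intro j
    have h2 := key j
    have h3 := expV_add_gap (m := m) h.1 (i := Fin.rev j) (by omega)
    have h4 := expU_rev m l k (Fin.rev j)
    rw [Fin.rev_rev] at h4
    rw [sum_expU h.1]
    omega

/-- For `N = r` this matches the common order at `0` of the Wronskians of `V` with the power of `x`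
in `∏ T_s^{r-s}`. -/
theorem sum_natLowSum (m : Fin r → ℕ) (N : ℕ) :
    ∑ j ∈ Finset.range N, natLowSum m j =
      ∑ j ∈ Finset.range N, j + ∑ s ∈ Finset.Icc 1 N, entry m s * (N - s) := by
  induction N with
  | zero => simp
  | succ N ih =>
    have : ∀ s ∈ Finset.Icc 1 N, entry m s * (N + 1 - s) =
        entry m s * (N - s) + entry m s := fun s hs => by
      rw [Finset.mem_Icc] at hs
      rw [Nat.sub_add_comm hs.2]
      ring
    rw [Finset.sum_range_succ, ih, Finset.sum_range_succ, Finset.sum_Icc_succ_top (by omega),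
      Finset.sum_congr rfl this, Finset.sum_add_distrib, natLowSum, Nat.sub_self]
    ring

theorem prod_polyT (hr : 1 ≤ r) (m : Fin r → ℕ) (k : ℕ) :
    ∏ s ∈ Finset.Icc 1 (r - 1), polyT m k s ^ (r - s) =
      X ^ (∑ s ∈ Finset.Icc 1 r, entry m s * (r - s)) * (X - C 1) ^ ((r - 1) * k) := by
  have h1 : ∑ s ∈ Finset.Icc 1 r, entry m s * (r - s) =
      ∑ s ∈ Finset.Icc 1 (r - 1), entry m s * (r - s) := by
    symm
    refine Finset.sum_subset (Finset.Icc_subset_Icc_right (Nat.sub_le r 1)) fun s hs hs' => ?_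
    rw [Finset.mem_Icc] at hs hs'
    rw [show r - s = 0 by omega, mul_zero]
  simp only [polyT, mul_pow, Finset.prod_mul_distrib, ← pow_mul]
  rw [Finset.prod_pow_eq_pow_sum, ← h1, mul_comm]
  congr 1
  simp only [ite_pow, one_pow]
  rw [Finset.prod_ite_eq']
  split_ifs with h
  · rw [← pow_mul, map_one, mul_comm]
  · have : r - 1 = 0 := by
      rw [Finset.mem_Icc] at h
      omega
    rw [this]
    simp

/-- A space `U` is spanned by its `u_i x^{ordU i}`, and the explicit formula for `u_i` involves only
`m, l, k`. -/
theorem isSpaceU_unique (hr : 1 ≤ r) (h : Consistent m l k) {U U' : Submodule ℂ ℂ[X]}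
    (hU : IsSpaceU m l k U) (hU' : IsSpaceU m l k U') : U = U' := by
  obtain ⟨u, hu⟩ := exists_isUBasis hr h hU
  obtain ⟨u', hu'⟩ := exists_isUBasis hr h hU'
  have : u = u' := funext fun i => by
    have hw : Equiv.swap (Fin.last r) (Fin.rev i) (Fin.last r) = Fin.rev i :=
      Equiv.swap_apply_left _ _
    rw [(isUBasis_explicit hr h hU hu i _ hw).2, (isUBasis_explicit hr h hU' hu' i _ hw).2]
  rw [← hu.2.2, ← hu'.2.2, this]

/-- This is the least degree occurring in `U`, so subtracting the right multiple of `u 0` leaves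
zero. -/
theorem eq_of_natDegree_eq_expU_zero (hr : 1 ≤ r) (h : Consistent m l k)
    {U : Submodule ℂ ℂ[X]} (hU : IsSpaceU m l k U) {u : Fin (r + 1) → ℂ[X]}
    (hu : IsUBasis m l k U u) {p : ℂ[X]} (hp : p ∈ U) (hdeg : p.natDegree = expU m l k 0) :
    p = C p.leadingCoeff * u 0 := by
  obtain ⟨-, -, -, -, hinf⟩ := (isSpaceU_iff hr).1 hU
  obtain ⟨hmonic, hudeg⟩ := hu.1 0
  have hordU : ordU m 0 = 0 := by simp [ordU]
  have hu0 : u 0 ∈ U := by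
    have : u 0 * X ^ ordU m ((0 : Fin (r + 1)) : ℕ) ∈ U := by
      rw [← hu.2.2]
      exact Submodule.subset_span ⟨0, rfl⟩
    rwa [Fin.val_zero, hordU, pow_zero, mul_one] at this
  have hE : (u 0).natDegree = expU m l k 0 := by
    rw [hudeg, expU, hordU, zero_add]
    rfl
  by_contra hne
  have hmem : p - C p.leadingCoeff * u 0 ∈ U := by
    rw [← smul_eq_C_mul]
    exact U.sub_mem hp (U.smul_mem _ hu0)
  have hne' := sub_ne_zero.2 hne
  obtain ⟨j, hj⟩ : (p - C p.leadingCoeff * u 0).natDegree ∈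
    Set.range fun j : Fin (r + 1) => expU m l k j := hinf ▸ ⟨_, hmem, hne', rfl⟩
  have hge : expU m l k 0 ≤ expU m l k j := (expU_strictMono h).monotone (Fin.zero_le j)
  have hle : (p - C p.leadingCoeff * u 0).natDegree ≤ expU m l k 0 :=
    (natDegree_sub_le _ _).trans (max_le hdeg.le ((natDegree_C_mul_le _ _).trans hE.le))
  have hlead : (p - C p.leadingCoeff * u 0).coeff (expU m l k 0) = 0 := by
    have h1 : (u 0).coeff (expU m l k 0) = 1 := by rw [← hE, hmonic.coeff_natDegree]
    have h2 : p.coeff (expU m l k 0) = p.leadingCoeff := by rw [← hdeg, leadingCoeff]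
    rw [coeff_sub, coeff_C_mul, h1, h2, mul_one, sub_self]
  have heq : (p - C p.leadingCoeff * u 0).natDegree = expU m l k 0 :=
    le_antisymm hle (by rw [← hj]; exact hge)
  rw [← heq] at hlead
  exact hne' (leadingCoeff_eq_zero.1 hlead)

/-- The divided Wronskians of `V` form a space with the exponents of `U`, hence `U` itself by
uniqueness. Omitting the basis element of largest degree gives the element of least degree, a
multiple of `u 0`. -/
theorem isY_last_iff (hr : 1 ≤ r) (h : Consistent m l k) {U : Submodule ℂ ℂ[X]}
    (hU : IsSpaceU m l k U) {u : Fin (r + 1) → ℂ[X]} (hu : IsUBasis m l k U u)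
    {V : Submodule ℂ ℂ[X]} (hV : IsSpaceV m l k V) {f : Fin (r + 1) → ℂ[X]}
    (hf : IsFlagBasis m l k V f) (y : ℂ[X]) : IsY m k f (Fin.last r) y ↔ y = u 0 := by
  obtain ⟨hdim, h0, h1, hz, hinf⟩ := isSpaceV_iff.1 hV
  have hli := linearIndependent_of_natDegree (expV_strictMono h.1 h).injective
    (fun j => (hf j).2.1) fun j => (hf j).2.2
  have hspan := span_eq_of_linearIndependent hdim (fun j => (hf j).1) hli
  set A := ∑ s ∈ Finset.Icc 1 r, entry m s * (r - s) with hA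
  have hsum : A + ∑ i : Fin r, (i : ℕ) + natLowSum m r = ∑ i : Fin (r + 1), natLowSum m i := by
    rw [Fin.sum_univ_eq_sum_range (natLowSum m), Finset.sum_range_succ, sum_natLowSum,
      Fin.sum_univ_eq_sum_range fun i => i]
    ring
  have hk : (r - 1) * k + k = r * k := by
    obtain ⟨r', hr'⟩ := Nat.exists_eq_add_of_le' hr
    rw [hr', Nat.add_sub_cancel]
    ring
  have hε : ∀ j : Fin (r + 1), expU m l k (Fin.rev j) + (A + (r - 1) * k) +
      ∑ i : Fin r, (i : ℕ) + expV m l k j = ∑ i : Fin (r + 1), expV m l k i := fun j => by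
    have h2 := ordU_rev m j
    have h3 := expV_add_gap (m := m) h.1 (i := j) (by omega)
    have h4 := expU_rev m l k j
    rw [sum_expV h.1]
    omega
  obtain ⟨hdvd, hdual⟩ := divided_dualSpan (f := f) hli hspan A ((r - 1) * k)
    (α₀ := fun j : Fin (r + 1) => natLowSum m j)
    (natLowSum_strictMono m |>.injective.comp Fin.val_injective) (fun i j hij => by
      refine Fin.ext ?_
      split_ifs at hij <;> omega) (expV_strictMono h.1 h).injective h0 h1 hz hinf
    (δ₀ := fun j : Fin (r + 1) => ordU m j)
    (δ₁ := fun j : Fin (r + 1) => (j : ℕ) + if (j : ℕ) = r then k else 0)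
    (ε := fun j : Fin (r + 1) => expU m l k j) (fun j => by
      have := ordU_rev m j
      omega) (fun j => by
      rw [sum_ite_zero]
      simp only [Fin.val_rev]
      split_ifs <;> omega) hε
  have hUeq := isSpaceU_unique hr h ((isSpaceU_iff hr).2 hdual) hU
  have hTm := (X_pow_mul_facts A ((r - 1) * k)).1
  have hTd := (X_pow_mul_facts A ((r - 1) * k)).2.2.2.2
  have hw : (fun b : Fin ((Fin.last r : Fin (r + 1)) : ℕ) =>
      f (Fin.castLE (Fin.last r).isLt.le b)) = fun b : Fin r => f ((Fin.last r).succAbove b) := by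
    funext b
    rw [Fin.succAbove_last]
    rfl
  have hmem : wronskianDet (fun b : Fin r => f ((Fin.last r).succAbove b)) ∈ dualSpan f :=
    Submodule.subset_span ⟨Fin.last r, rfl⟩
  obtain ⟨p, hp⟩ := hdvd _ hmem
  have hpU : p ∈ U := by
    rw [← hUeq, mem_divided, ← hp]
    exact hmem
  obtain ⟨hwne, hwdeg⟩ := wronskianDet_degree (f := fun b : Fin r => f ((Fin.last r).succAbove b))
    (β := fun b : Fin r => expV m l k ((Fin.last r).succAbove b))
    ((expV_strictMono h.1 h).injective.comp Fin.succAbove_right_injective)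
    (fun b => (hf _).2.1) fun b => (hf _).2.2
  have hp0 : p ≠ 0 := fun h0 => hwne (by rw [hp, h0, mul_zero])
  have hpdeg : p.natDegree = expU m l k 0 := by
    have h2 := hε (Fin.last r)
    have h3 := sum_succAbove_add (α := fun j : Fin (r + 1) => expV m l k j) (Fin.last r)
    rw [hp, natDegree_mul hTm.ne_zero hp0, hTd] at hwdeg
    rw [Fin.rev_last, Fin.val_zero] at h2
    omega
  have hpu := eq_of_natDegree_eq_expU_zero hr h hU hu hpU hpdeg
  have hc : p.leadingCoeff ≠ 0 := leadingCoeff_ne_zero.2 hp0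
  have hum := (hu.1 0).1
  have hT : ∏ s ∈ Finset.Icc 1 (((Fin.last r : Fin (r + 1)) : ℕ) - 1),
      polyT m k s ^ (((Fin.last r : Fin (r + 1)) : ℕ) - s) =
      X ^ A * (X - C 1) ^ ((r - 1) * k) := prod_polyT hr m k
  rw [IsY, hT, hw]
  have hp' : wronskianDet (fun b : Fin r => f ((Fin.last r).succAbove b)) =
      C p.leadingCoeff * u 0 * (X ^ A * (X - C 1) ^ ((r - 1) * k)) := by
    rw [hp, ← hpu, mul_comm]
  constructor
  · rintro ⟨hy, c, hc0, hcy⟩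
    have h2 : C c * y = C p.leadingCoeff * u 0 :=
      mul_right_cancel₀ hTm.ne_zero (hcy.symm.trans hp')
    have h3 := congrArg leadingCoeff h2
    rw [leadingCoeff_mul, leadingCoeff_mul, leadingCoeff_C, leadingCoeff_C, hy.leadingCoeff,
      hum.leadingCoeff, mul_one, mul_one] at h3
    rw [h3] at h2
    exact mul_left_cancel₀ (C_ne_zero.2 hc) h2
  · rintro rfl
    exact ⟨hum, p.leadingCoeff, hc, hp'⟩

end Duality

/-! ### Uniqueness and existence of rational extensions -/

section RationalExtension

variable {N : ℕ}

theorem aeval_natCast_point (a : Fin N → ℕ) (F : MvPolynomial (Fin N) ℚ) :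
    MvPolynomial.aeval (fun i => (a i : ℂ)) F =
      ((MvPolynomial.eval (fun i => (a i : ℚ)) F : ℚ) : ℂ) := by
  have h := MvPolynomial.aeval_algebraMap_apply ℂ (fun i => (a i : ℚ)) F
  have hpt : (algebraMap ℚ ℂ ∘ fun i => (a i : ℚ)) = fun i => (a i : ℂ) := by
    funext i
    simp
  rw [← hpt, h]
  rfl

/-- Natural points with all coordinates at least `B` are Zariski dense. Two fractions that agree on
them satisfy `Q' P = Q P'` identically, and neither denominator vanishes at `x`. -/
theorem IsRationalExtension.unique {S : Set ((Fin N → ℂ) × ℂ[X])} {x : Fin N → ℂ} {p p' : ℂ[X]}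
    (B : ℕ) (hS : ∀ a : Fin N → ℕ, (∀ i, B ≤ a i) → ∃ q, ((fun i => (a i : ℂ)), q) ∈ S)
    (hp : IsRationalExtension S x p) (hp' : IsRationalExtension S x p') : p = p' := by
  obtain ⟨P, Q, hPQ, hQ, hP⟩ := hp
  obtain ⟨P', Q', hPQ', hQ', hP'⟩ := hp'
  have hmul : ∀ (y : Fin N → ℂ) (F : MvPolynomial (Fin N) ℚ) (G : (MvPolynomial (Fin N) ℚ)[X]),
      (C F * G).map (MvPolynomial.aeval y : _ →ₐ[ℚ] ℂ).toRingHom =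
        C (MvPolynomial.aeval y F) * G.map (MvPolynomial.aeval y : _ →ₐ[ℚ] ℂ).toRingHom := by
    intro y F G
    rw [Polynomial.map_mul, map_C]
    rfl
  have key : C Q' * P = C Q * P' := by
    ext1 t
    have hinf : ∀ i : Fin N, (Set.range fun b : ℕ => ((B + b : ℕ) : ℚ)).Infinite := fun i =>
      Set.infinite_range_of_injective fun a b hab => by
        have : B + a = B + b := Nat.cast_injective hab
        omega
    refine MvPolynomial.funext_set _ hinf fun z hz => ?_
    have hz' : ∀ i, ∃ b : ℕ, ((B + b : ℕ) : ℚ) = z i := fun i => hz i (Set.mem_univ i)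
    choose b hb using hz'
    obtain rfl : (fun i => ((B + b i : ℕ) : ℚ)) = z := funext hb
    obtain ⟨q, hq⟩ := hS (fun i => B + b i) fun i => Nat.le_add_right _ _
    have h1 : (C Q' * P).map (MvPolynomial.aeval fun i => ((B + b i : ℕ) : ℂ)).toRingHom =
        (C Q * P').map (MvPolynomial.aeval fun i => ((B + b i : ℕ) : ℂ)).toRingHom := by
      rw [hmul, hmul, ← (hPQ _ _ hq).2, ← (hPQ' _ _ hq).2]
      ring
    have h2 := congrArg (fun f => f.coeff t) h1
    simp only [coeff_map] at h2
    have h3 : MvPolynomial.aeval (fun i => ((B + b i : ℕ) : ℂ)) ((C Q' * P).coeff t) =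
      MvPolynomial.aeval (fun i => ((B + b i : ℕ) : ℂ)) ((C Q * P').coeff t) := h2
    rw [aeval_natCast_point, aeval_natCast_point] at h3
    exact_mod_cast h3
  have h := congrArg (fun f => f.map (MvPolynomial.aeval x : _ →ₐ[ℚ] ℂ).toRingHom) key
  simp only [hmul] at h
  rw [← hP, ← hP'] at h
  refine mul_left_cancel₀ (C_ne_zero.2 (mul_ne_zero hQ' hQ)) ?_
  rw [C_mul]
  linear_combination h

/-- The polynomial `∑ (-1)^i binom(n, i) (∏_{j < i} a_j / b_j) x^{n-i}`. -/
def hyperPoly (n : ℕ) (a b : ℕ → ℂ) : ℂ[X] :=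
  ∑ i ∈ Finset.range (n + 1),
    C ((-1) ^ i * ((n.choose i : ℂ) * ∏ j ∈ Finset.range i, a j / b j)) * X ^ (n - i)

/-- The polynomial `hyperPoly`, multiplied by all denominators, over a ring. -/
def hyperNumerator {R : Type*} [CommRing R] (n : ℕ) (a b : ℕ → R) : R[X] :=
  ∑ i ∈ Finset.range (n + 1), C ((-1) ^ i * ((n.choose i : R) *
    ((∏ j ∈ Finset.range i, a j) * ∏ j ∈ Finset.Ico i n, b j))) * X ^ (n - i)

theorem hyperNumerator_map {R R' : Type*} [CommRing R] [CommRing R'] (φ : R →+* R') (n : ℕ)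
    (a b : ℕ → R) :
    (hyperNumerator n a b).map φ = hyperNumerator n (fun j => φ (a j)) fun j => φ (b j) := by
  rw [hyperNumerator, hyperNumerator, Polynomial.map_sum]
  refine Finset.sum_congr rfl fun i _ => ?_
  rw [Polynomial.map_mul, map_C, Polynomial.map_pow, map_X]
  simp only [map_mul, map_pow, map_neg, map_one, map_natCast, map_prod φ]

/-- The `i`-th term contains the denominators with `j < i` only, so the common denominator leaves
the factors with `i ≤ j < n`. -/
theorem C_prod_mul_hyperPoly {n : ℕ} {a b : ℕ → ℂ} (hb : ∀ j < n, b j ≠ 0) :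
    C (∏ j ∈ Finset.range n, b j) * hyperPoly n a b = hyperNumerator n a b := by
  rw [hyperPoly, hyperNumerator, Finset.mul_sum]
  refine Finset.sum_congr rfl fun i hi => ?_
  have hi' : i ≤ n := Nat.lt_succ_iff.1 (Finset.mem_range.1 hi)
  have hne : ∏ j ∈ Finset.range i, b j ≠ 0 := Finset.prod_ne_zero_iff.2 fun j hj =>
    hb j ((Finset.mem_range.1 hj).trans_le hi')
  rw [← mul_assoc, ← C_mul, ← Finset.prod_range_mul_prod_Ico _ hi', Finset.prod_div_distrib]
  congr 2
  field_simp

theorem isRationalExtension_hyperPoly {S : Set ((Fin N → ℂ) × ℂ[X])} {x : Fin N → ℂ} {n : ℕ}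
    (a b : ℕ → MvPolynomial (Fin N) ℚ)
    (hS : ∀ y q, (y, q) ∈ S → (∀ j < n, MvPolynomial.aeval y (b j) ≠ 0) ∧
      q = hyperPoly n (fun j => MvPolynomial.aeval y (a j)) fun j => MvPolynomial.aeval y (b j))
    (hx : ∀ j < n, MvPolynomial.aeval x (b j) ≠ 0) :
    IsRationalExtension S x
      (hyperPoly n (fun j => MvPolynomial.aeval x (a j)) fun j => MvPolynomial.aeval x (b j)) := by
  have key : ∀ y : Fin N → ℂ, (∀ j < n, MvPolynomial.aeval y (b j) ≠ 0) →
      MvPolynomial.aeval y (∏ j ∈ Finset.range n, b j) ≠ 0 ∧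
      C (MvPolynomial.aeval y (∏ j ∈ Finset.range n, b j)) *
        hyperPoly n (fun j => MvPolynomial.aeval y (a j)) (fun j => MvPolynomial.aeval y (b j)) =
        (hyperNumerator n a b).map (MvPolynomial.aeval y : _ →ₐ[ℚ] ℂ).toRingHom := by
    intro y hy
    rw [map_prod]
    refine ⟨Finset.prod_ne_zero_iff.2 fun j hj => hy j (Finset.mem_range.1 hj), ?_⟩
    rw [C_prod_mul_hyperPoly hy, hyperNumerator_map]
    rfl
  refine ⟨hyperNumerator n a b, ∏ j ∈ Finset.range n, b j, fun y q hyq => ?_, key x hx⟩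
  obtain ⟨hb, rfl⟩ := hS y q hyq
  exact key y hb

end RationalExtension

/-! ### Specialization of the factors under ring homomorphisms -/

section Maps

variable {R R' : Type*} [CommRing R] [CommRing R'] (φ : R →+* R') {r : ℕ}

theorem map_entry (a : Fin r → R) (t : ℕ) : φ (entry a t) = entry (fun i => φ (a i)) t := by
  unfold entry
  split_ifs <;> simp

theorem map_ringGap (k : R) (l : Fin r → R) (i : ℕ) :
    φ (ringGap k l i) = ringGap (φ k) (fun i => φ (l i)) i := by
  unfold ringGap extL
  split_ifs <;> simp [map_entry]

theorem map_lowSum (m : Fin r → R) (i : ℕ) :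
    φ (lowSum m i) = lowSum (fun i => φ (m i)) i := by
  simp [lowSum, map_entry]

theorem map_numTerm (m : Fin r → R) (k : R) (l : Fin r → R) (v q : Fin (r + 1)) (j : ℕ) :
    φ (numTerm m k l v q j) = numTerm (fun i => φ (m i)) (φ k) (fun i => φ (l i)) v q j := by
  simp [numTerm, map_lowSum, map_ringGap]

theorem map_denTerm (m : Fin r → R) (k : R) (l : Fin r → R) (v q : Fin (r + 1)) (j : ℕ) :
    φ (denTerm m k l v q j) = denTerm (fun i => φ (m i)) (φ k) (fun i => φ (l i)) v q j := by
  simp [denTerm, map_lowSum, map_ringGap]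

end Maps

/-! ### The explicit formula at complex parameters -/

section ComplexParameters

variable {r : ℕ}

theorem explicitU_weyl_eq_hyperPoly (hr : 1 ≤ r) (n : ℕ) (w : Equiv.Perm (Fin (r + 1)))
    (m l : Fin r → ℂ) (k : ℂ) :
    explicitU n (weylM w m) (weylL w k l) k = hyperPoly n
      (fun j => ∏ q ∈ Finset.univ.erase (w (Fin.last r)), numTerm m k l (w (Fin.last r)) q j)
      (fun j => ∏ q ∈ Finset.univ.erase (w (Fin.last r)), denTerm m k l (w (Fin.last r)) q j) := by
  rw [explicitU, hyperPoly]
  refine Finset.sum_congr rfl fun i _ => ?_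
  rw [coeffC_weyl hr]
  simp only [Finset.prod_div_distrib]

/-- If a set of pairs is given by the explicit formula with parameters that are polynomials in the
point, and it lies over all large points with natural coordinates, its rational extension is given
by the same formula. -/
theorem isRationalExtension_iff_explicitU (hr : 1 ≤ r) {N : ℕ} {S : Set ((Fin N → ℂ) × ℂ[X])}
    (B n : ℕ) (hB : ∀ a : Fin N → ℕ, (∀ i, B ≤ a i) → ∃ q, ((fun i => (a i : ℂ)), q) ∈ S)
    (w : Equiv.Perm (Fin (r + 1))) (μ : Fin r → MvPolynomial (Fin N) ℚ)
    (κ : MvPolynomial (Fin N) ℚ) (l : Fin r → ℕ)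
    (hS : ∀ y q, (y, q) ∈ S →
      DenNonzero n (weylM w fun t => MvPolynomial.aeval y (μ t))
        (weylL w (MvPolynomial.aeval y κ) (toC l)) (MvPolynomial.aeval y κ) ∧
      q = explicitU n (weylM w fun t => MvPolynomial.aeval y (μ t))
        (weylL w (MvPolynomial.aeval y κ) (toC l)) (MvPolynomial.aeval y κ))
    {x : Fin N → ℂ} {m : Fin r → ℂ} {k : ℂ} (hm : ∀ t, MvPolynomial.aeval x (μ t) = m t)
    (hk : MvPolynomial.aeval x κ = k) (hx : DenNonzero n (weylM w m) (weylL w k (toC l)) k)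
    (p : ℂ[X]) :
    IsRationalExtension S x p ↔ p = explicitU n (weylM w m) (weylL w k (toC l)) k := by
  -- The same factors formed over the polynomial ring, with `l` constant; evaluation at a point
  -- returns the complex ones.
  let a : ℕ → MvPolynomial (Fin N) ℚ := fun j => ∏ q ∈ Finset.univ.erase (w (Fin.last r)),
    numTerm μ κ (fun t => (l t : MvPolynomial (Fin N) ℚ)) (w (Fin.last r)) q j
  let b : ℕ → MvPolynomial (Fin N) ℚ := fun j => ∏ q ∈ Finset.univ.erase (w (Fin.last r)),
    denTerm μ κ (fun t => (l t : MvPolynomial (Fin N) ℚ)) (w (Fin.last r)) q j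
  have ha : ∀ (y : Fin N → ℂ) j, MvPolynomial.aeval y (a j) =
      ∏ q ∈ Finset.univ.erase (w (Fin.last r)), numTerm (fun t => MvPolynomial.aeval y (μ t))
        (MvPolynomial.aeval y κ) (toC l) (w (Fin.last r)) q j := fun y j => by
    rw [map_prod]
    refine Finset.prod_congr rfl fun q _ => ?_
    have := map_numTerm (MvPolynomial.aeval y : _ →ₐ[ℚ] ℂ).toRingHom μ κ
      (fun t => (l t : MvPolynomial (Fin N) ℚ)) (w (Fin.last r)) q j
    simp only [map_natCast] at this
    exact this
  have hb : ∀ (y : Fin N → ℂ) j, MvPolynomial.aeval y (b j) =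
      ∏ q ∈ Finset.univ.erase (w (Fin.last r)), denTerm (fun t => MvPolynomial.aeval y (μ t))
        (MvPolynomial.aeval y κ) (toC l) (w (Fin.last r)) q j := fun y j => by
    rw [map_prod]
    refine Finset.prod_congr rfl fun q _ => ?_
    have := map_denTerm (MvPolynomial.aeval y : _ →ₐ[ℚ] ℂ).toRingHom μ κ
      (fun t => (l t : MvPolynomial (Fin N) ℚ)) (w (Fin.last r)) q j
    simp only [map_natCast] at this
    exact this
  obtain rfl : (fun t => MvPolynomial.aeval x (μ t)) = m := funext hm
  subst hk
  have hext : IsRationalExtension S x (explicitU n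
      (weylM w fun t => MvPolynomial.aeval x (μ t))
      (weylL w (MvPolynomial.aeval x κ) (toC l)) (MvPolynomial.aeval x κ)) := by
    rw [explicitU_weyl_eq_hyperPoly hr]
    simp only [← ha, ← hb]
    refine isRationalExtension_hyperPoly a b (fun y q hyq => ?_) ?_
    · obtain ⟨h1, h2⟩ := hS y q hyq
      rw [denNonzero_weyl hr] at h1
      rw [explicitU_weyl_eq_hyperPoly hr] at h2
      simp only [← ha, ← hb] at h1 h2
      exact ⟨h1, h2⟩
    · rw [denNonzero_weyl hr] at hx
      simp only [← hb] at hx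
      exact hx
  exact ⟨fun h => h.unique B hB hext, fun h => h ▸ hext⟩

theorem entry_le_sum (l : Fin r → ℕ) (s : ℕ) : entry l s ≤ ∑ t, l t := by
  unfold entry
  split_ifs with h
  · exact Finset.single_le_sum (f := l) (fun _ _ => Nat.zero_le _) (Finset.mem_univ _)
  · exact Nat.zero_le _

theorem isPartitionBelow_of_antitone {l : Fin r → ℕ} (hl : Antitone l) {k : ℕ}
    (hk : ∑ t, l t ≤ k) : IsPartitionBelow l k := by
  intro i hi
  rcases Nat.eq_zero_or_pos i with rfl | hpos
  · exact (entry_le_sum l 1).trans hk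
  · rw [extL, extL, if_neg (by omega), if_neg (by omega), entry]
    split_ifs with h
    · rw [entry, dif_pos ⟨hpos, hi⟩]
      exact hl (Fin.mk_le_mk.2 (by omega))
    · exact Nat.zero_le _

/-- The sum of the `l_t` dominates every gap `l_s - l_{s+1}` with `s ≥ 1`; it serves as the uniform
bound `B` beyond which natural points are consistent. -/
theorem consistent_of_le {m l : Fin r → ℕ} {k : ℕ} (hl : IsPartitionBelow l k)
    (hm : ∀ t, ∑ t, l t ≤ m t) : Consistent m l k := by
  refine ⟨hl, fun s hs hsr => ?_⟩
  obtain ⟨s, rfl⟩ := Nat.exists_eq_add_of_le' hs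
  rw [entry_succ m (by omega), extL, if_neg (by omega)]
  exact ((entry_le_sum l _).trans (hm _)).trans (Nat.le_add_right _ _)

theorem isRationalExtension_graphMK_iff (hr : 1 ≤ r) {l : Fin r → ℕ} (hl : Antitone l)
    (i : Fin (r + 1)) (w : Equiv.Perm (Fin (r + 1))) (hi : (i : ℕ) < r)
    (hw : w (Fin.last r) = Fin.rev i) {n : ℕ}
    (hn : n = entry l (r - (i : ℕ)) - entry l (r - (i : ℕ) + 1)) (m : Fin r → ℂ) (k : ℂ)
    (hden : DenNonzero n (weylM w m) (weylL w k (toC l)) k) (p : ℂ[X]) :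
    IsRationalExtension (graphMK l i) (Fin.cons k m) p ↔
      p = explicitU n (weylM w m) (weylL w k (toC l)) k := by
  refine isRationalExtension_iff_explicitU hr (∑ t, l t) n (fun a ha => ?_) w
    (fun t => MvPolynomial.X t.succ) (MvPolynomial.X 0) l (fun y q hyq => ?_) (by simp) (by simp)
    hden p
  · have hc : Consistent (fun t : Fin r => a t.succ) l (a 0) :=
      consistent_of_le (isPartitionBelow_of_antitone hl (ha 0)) fun t => ha _
    obtain ⟨U, hU⟩ := exists_isSpaceU hr hc
    obtain ⟨u, hu⟩ := exists_isUBasis hr hc hU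
    refine ⟨u i, _, _, U, u, hc, hU, hu, ?_⟩
    congr 1
    funext t
    refine Fin.cases ?_ (fun t => ?_) t <;> simp [toC]
  · obtain ⟨m', k', U, u, hc, hU, hu, hz⟩ := hyq
    obtain ⟨rfl, rfl⟩ := Prod.mk.inj hz
    -- Since `i < r`, the index `r - i` is positive and the gap does not involve `l_0 = k`: the
    -- degree is constant along the graph.
    have hgap : n = gap k' l (r - (i : ℕ)) := by
      rw [hn, gap, extL, if_neg (by omega), extL, if_neg (by omega)]
    rw [hgap]
    simpa using isUBasis_explicit hr hc hU hu i w hw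

theorem isRationalExtension_graphM_iff (hr : 1 ≤ r) {l : Fin r → ℕ} {k : ℕ}
    (hl : IsPartitionBelow l k)
    (i : Fin (r + 1)) (w : Equiv.Perm (Fin (r + 1)))
    (hw : w (Fin.last r) = Fin.rev i) (m : Fin r → ℂ)
    (hden : DenNonzero (gap k l (r - (i : ℕ))) (weylM w m) (weylL w (k : ℂ) (toC l)) k)
    (p : ℂ[X]) :
    IsRationalExtension (graphM l k i) m p ↔
      p = explicitU (gap k l (r - (i : ℕ))) (weylM w m) (weylL w (k : ℂ) (toC l)) k := by
  refine isRationalExtension_iff_explicitU hr (∑ t, l t) _ (fun a ha => ?_) w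
    (fun t => MvPolynomial.X t) (k : MvPolynomial (Fin r) ℚ) l (fun y q hyq => ?_) (by simp)
    (by simp) hden p
  · have hc : Consistent a l k := consistent_of_le hl ha
    obtain ⟨U, hU⟩ := exists_isSpaceU hr hc
    obtain ⟨u, hu⟩ := exists_isUBasis hr hc hU
    exact ⟨u i, _, U, u, hc, hU, hu, rfl⟩
  · obtain ⟨m', U, u, hc, hU, hu, hz⟩ := hyq
    obtain ⟨rfl, rfl⟩ := Prod.mk.inj hz
    simpa using isUBasis_explicit hr hc hU hu i w hw

theorem isUBasis_explicit_zero (hr : 1 ≤ r) {m l : Fin r → ℕ} {k : ℕ} (h : Consistent m l k)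
    {U : Submodule ℂ ℂ[X]} (hU : IsSpaceU m l k U) {u : Fin (r + 1) → ℂ[X]}
    (hu : IsUBasis m l k U u) :
    DenNonzero (entry l r) (toC m) (toC l) k ∧
      u 0 = explicitU (entry l r) (toC m) (toC l) k := by
  have h1 := isUBasis_explicit hr h hU hu 0 1 (by simp)
  have hgap : gap k l (r - ((0 : Fin (r + 1)) : ℕ)) = entry l r := by
    rw [Fin.val_zero, Nat.sub_zero, gap, extL_succ_last, extL, if_neg (by omega), Nat.sub_zero]
  rwa [hgap, weylM_one, weylL_one] at h1

end ComplexParameters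

end

end BetheSpaces

/-! ### Assembly of the proposition -/

theorem mainTheorem9 (r : ℕ) (hr : 1 ≤ r) :
    -- consistent parameters
    (∀ (m l : Fin r → ℕ) (k : ℕ), Consistent m l k →
      (∃! U : Submodule ℂ ℂ[X], IsSpaceU m l k U) ∧
      (∃ V : Submodule ℂ ℂ[X], IsSpaceV m l k V) ∧
      ∀ U : Submodule ℂ ℂ[X], IsSpaceU m l k U →
        (∃! u : Fin (r + 1) → ℂ[X], IsUBasis m l k U u) ∧
        ∀ u : Fin (r + 1) → ℂ[X], IsUBasis m l k U u →
          -- the first basis polynomial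
          (DenNonzero (entry l r) (toC m) (toC l) k ∧
            u 0 = explicitU (entry l r) (toC m) (toC l) k) ∧
          -- all basis polynomials, through the Weyl group
          (∀ (i : Fin (r + 1)) (w : Equiv.Perm (Fin (r + 1))), w (Fin.last r) = Fin.rev i →
            DenNonzero (gap k l (r - (i : ℕ))) (weylM w (toC m)) (weylL w (k : ℂ) (toC l)) k ∧
            u i = explicitU (gap k l (r - (i : ℕ)))
              (weylM w (toC m)) (weylL w (k : ℂ) (toC l)) k) ∧
          -- the polynomial `y_r`
          (∀ V : Submodule ℂ ℂ[X], IsSpaceV m l k V →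
            ∀ f : Fin (r + 1) → ℂ[X], IsFlagBasis m l k V f →
              ∀ y : ℂ[X], IsY m k f (Fin.last r) y ↔
                y = explicitU (entry l r) (toC m) (toC l) k)) ∧
    -- `u_0` at complex `m, k`
    (∀ l : Fin r → ℕ, Antitone l →
      ∀ (m : Fin r → ℂ) (k : ℂ), DenNonzero (entry l r) m (toC l) k →
        ∀ p : ℂ[X], IsRationalExtension (graphMK l 0) (Fin.cons k m) p ↔
          p = explicitU (entry l r) m (toC l) k) ∧
    -- `u_i` for `i < r` at complex `m, k`
    (∀ l : Fin r → ℕ, Antitone l →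
      ∀ (i : Fin (r + 1)) (w : Equiv.Perm (Fin (r + 1))),
        (i : ℕ) < r → w (Fin.last r) = Fin.rev i →
        ∀ n : ℕ, n = entry l (r - (i : ℕ)) - entry l (r - (i : ℕ) + 1) →
        ∀ (m : Fin r → ℂ) (k : ℂ), DenNonzero n (weylM w m) (weylL w k (toC l)) k →
          ∀ p : ℂ[X], IsRationalExtension (graphMK l i) (Fin.cons k m) p ↔
            p = explicitU n (weylM w m) (weylL w k (toC l)) k) ∧
    -- all `u_i`, for fixed `l, k`, at complex `m`
    (∀ (l : Fin r → ℕ) (k : ℕ), IsPartitionBelow l k →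
      ∀ (i : Fin (r + 1)) (w : Equiv.Perm (Fin (r + 1))), w (Fin.last r) = Fin.rev i →
        ∀ m : Fin r → ℂ,
          DenNonzero (gap k l (r - (i : ℕ))) (weylM w m) (weylL w (k : ℂ) (toC l)) k →
          ∀ p : ℂ[X], IsRationalExtension (graphM l k i) m p ↔
            p = explicitU (gap k l (r - (i : ℕ))) (weylM w m) (weylL w (k : ℂ) (toC l)) k) := by
  refine ⟨fun m l k h => ⟨?_, exists_isSpaceV hr h, fun U hU => ⟨?_, fun u hu =>
      ⟨isUBasis_explicit_zero hr h hU hu, fun i w hw => isUBasis_explicit hr h hU hu i w hw,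
        fun V hV f hf y => ?_⟩⟩⟩,
    fun l hl m k hden p => ?_,
    fun l hl i w hi hw n hn m k hden p =>
      isRationalExtension_graphMK_iff hr hl i w hi hw hn m k hden p,
    fun l k hl i w hw m hden p => isRationalExtension_graphM_iff hr hl i w hw m hden p⟩
  · obtain ⟨U, hU⟩ := exists_isSpaceU hr h
    exact ⟨U, hU, fun U' hU' => isSpaceU_unique hr h hU' hU⟩
  · obtain ⟨u, hu⟩ := exists_isUBasis hr h hU
    refine ⟨u, hu, fun u' hu' => funext fun i => ?_⟩
    -- Any permutation sending `r` to `r - i` makes the formula available; a transposition is the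
    -- simplest.
    have hw : Equiv.swap (Fin.last r) (Fin.rev i) (Fin.last r) = Fin.rev i :=
      Equiv.swap_apply_left _ _
    rw [(isUBasis_explicit hr h hU hu i _ hw).2, (isUBasis_explicit hr h hU hu' i _ hw).2]
  · rw [← (isUBasis_explicit_zero hr h hU hu).2]
    exact isY_last_iff hr h hU hu hV hf y
  · have hkey := isRationalExtension_graphMK_iff hr hl 0 1 hr (by simp)
      (n := entry l r) (by
        have h0 : entry l (r + 1) = 0 := dif_neg (by omega)
        simp [h0]) m k (by rwa [weylM_one, weylL_one]) p
    rwa [weylM_one, weylL_one] at hkey
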